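/- Let $\overline{\mathbb Q}$ be an algebraic closure of $\mathbb Q$, let $\mathbb G_m^2(\overline{\mathbb Q})=(\overline{\mathbb Q}^{\times})^2$ be the two-dimensional torus, and let it act on $\mathbb P^2(\overline{\mathbb Q})$ by $$\omega\,[\xi_0:\xi_1:\xi_2]=[\xi_0:\omega_1\xi_1:\omega_2\xi_2].$$ Let $C\subset\mathbb P^2(\overline{\mathbb Q})$ be the line $x_0+x_1+x_2=0$. For $\omega\neq(1,1)$ the intersection $C\cap\omega C$ consists of a single point, and $\mathrm h(C\cap\omega C)$ denotes the canonical height of that point: for $\xi=[\xi_0:\xi_1:\xi_2]$ with coordinates in a number field $K$, $$\mathrm h(\xi)=\sum_{v}\sum_{w\mid v}\frac{[K_w:\mathbb Q_v]}{[K:\mathbb Q]}\log\max(|\xi_0|_w,|\xi_1|_w,|\xi_2|_w),$$ where $v$ runs over the places of $\mathbb Q$, $w$ over the places of $K$ above $v$, and $|\cdot|_w$ extends the usual absolute value $|\cdot|_v$; the value depends neither on the homogeneous coordinates nor on $K$. Set $$\eta=\frac{2\,\zeta(3)}{3\,\zeta(2)}.$$ A sequence $(W_\ell)_{\ell\ge1}$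 of nonempty finite subsets of $\mathbb G_m^2(\overline{\mathbb Q})$ is called strict if $$\lim_{\ell\to+\infty}\frac{\#(W_\ell\cap H)}{\#W_\ell}=0$$ for every proper algebraic subgroup $H$ of $\mathbb G_m^2(\overline{\mathbb Q})$. **Theorem 5.5.** Let $(W_\ell)_{\ell\ge1}$ be a strict sequence of nonempty finite subsets of $\mathbb G_m^2(\overline{\mathbb Q})$ all of whose elements are nontrivial torsion points (that is, torsion points different from $(1,1)$). Then for each $\varepsilon>0$ $$\lim_{\ell\to+\infty}\frac{\#\{\omega\in W_\ell : |\mathrm h(C\cap\omega C)-\eta|<\varepsilon\}}{\#W_\ell}=1.$$ Moreover $$\lim_{\ell\to+\infty}\frac1{\#W_\ell}\sum_{\omega\in W_\ell}\mathrm h(C\cap\omega C)=\eta.$$ -/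

import Mathlib

open Filter Topology

namespace TorusHeight

/-- The field of algebraic numbers: an algebraic closure of the rationals. -/
abbrev QBar : Type := AlgebraicClosure ℚ

instance : Algebra.IsAlgebraic ℚ QBar := AlgebraicClosure.isAlgebraic ℚ

/-- The group of algebraic points of the split torus of dimension `n`,
under coordinatewise multiplication. -/
abbrev Torus (n : ℕ) : Type := Fin n → QBarˣ

/-- The set of algebraic points of the projective space of dimension `n`. -/
abbrev Proj (n : ℕ) : Type := Projectivization QBar (Fin (n + 1) → QBar)

/-- A subgroup of the torus is algebraic if it is the zero set in the torus of a family of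
polynomials. (Multiplying by a monomial does not change the zero set in the torus, so Laurent
polynomials would give the same notion.) -/
def IsAlgebraicSubgroup {n : ℕ} (H : Subgroup (Torus n)) : Prop :=
  ∃ S : Set (MvPolynomial (Fin n) QBar),
    ∀ γ : Torus n, γ ∈ H ↔ ∀ p ∈ S, MvPolynomial.eval (fun i => (γ i : QBar)) p = 0

/-- A sequence of nonempty finite subsets of `V` is strict in `V` if, for every algebraic
subgroup `H` of the torus that does not contain `V`, the proportion of the points of `E ℓ` lying
in `H` tends to zero. -/
def IsStrict {n : ℕ} (V : Set (Torus n)) (E : ℕ → Finset (Torus n)) : Prop :=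
  (∀ ℓ, (E ℓ).Nonempty ∧ (E ℓ : Set (Torus n)) ⊆ V) ∧
    ∀ H : Subgroup (Torus n), IsAlgebraicSubgroup H → ¬ V ⊆ (H : Set (Torus n)) →
      Tendsto (fun ℓ => (((E ℓ : Set (Torus n)) ∩ (H : Set (Torus n))).ncard : ℝ) / ((E ℓ).card : ℝ))
        atTop (𝓝 0)

/-- The zero set in projective space of a homogeneous polynomial. -/
def zeroSet {n : ℕ} (f : MvPolynomial (Fin (n + 1)) QBar) : Set (Proj n) :=
  {ξ | ∀ v ∈ ξ.submodule, MvPolynomial.eval v f = 0}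

/-- The linear automorphism `(x₀, x₁, …, xₙ) ↦ (x₀, γ₁ x₁, …, γₙ xₙ)`. -/
noncomputable def diagonal {n : ℕ} (γ : Torus n) :
    (Fin (n + 1) → QBar) ≃ₗ[QBar] (Fin (n + 1) → QBar) :=
  LinearEquiv.piCongrRight fun i =>
    LinearEquiv.smulOfUnit ((Fin.cons 1 γ : Fin (n + 1) → QBarˣ) i)

/-- The translation `[ξ₀ : ξ₁ : … : ξₙ] ↦ [ξ₀ : γ₁ ξ₁ : … : γₙ ξₙ]` of projective space. -/
noncomputable def translate {n : ℕ} (γ : Torus n) : Proj n → Proj n :=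
  Projectivization.map (diagonal γ).toLinearMap (diagonal γ).injective

/-- The subfield of the algebraic numbers generated by the coordinates of a vector. -/
noncomputable def coordField {n : ℕ} (v : Fin (n + 1) → QBar) : IntermediateField ℚ QBar :=
  IntermediateField.adjoin ℚ (Set.range v)

/-- The coordinates of a vector generate a number field. -/
instance coordField_numberField {n : ℕ} (v : Fin (n + 1) → QBar) :
    NumberField (coordField v) := by
  have : FiniteDimensional ℚ (coordField v) :=
    IntermediateField.finiteDimensional_adjoin fun x _ =>
      (Algebra.IsAlgebraic.isAlgebraic x).isIntegral
  exact ⟨⟩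

/-- A vector, seen with coordinates in the number field that they generate. -/
noncomputable def coords {n : ℕ} (v : Fin (n + 1) → QBar) : Fin (n + 1) → coordField v :=
  fun i => ⟨v i, IntermediateField.subset_adjoin ℚ _ (Set.mem_range_self i)⟩

/-- The canonical (absolute logarithmic Weil) height of a point of projective space, computed
with a vector `v` of homogeneous coordinates and the number field `K` generated by them. It
depends neither on the vector nor on the choice of a number field containing its coordinates.
For a number field `K`, `Height.logHeight` is the sum over the places `w` of `K`
of `[K_w : ℚ_v] * log max |v i|_w`, not divided by `[K : ℚ]`. -/
noncomputable def height {n : ℕ} (ξ : Proj n) : ℝ :=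
  Height.logHeight (coords ξ.rep) / (Module.finrank ℚ (coordField ξ.rep) : ℝ)

/-- The projective line `x₀ + x₁ + x₂ = 0` in the projective plane. -/
noncomputable def lineC : Set (Proj 2) :=
  zeroSet (MvPolynomial.X 0 + MvPolynomial.X 1 + MvPolynomial.X 2)

/-- The height of the intersection of the line `C` with its translate by `ω`: the sum of the
heights of its points. For `ω ≠ 1` the intersection is a single point
(`lineC_inter_translate_eq_singleton` below), so that this is the height of that point. -/
noncomputable def interHeight (ω : Torus 2) : ℝ :=
  ∑ᶠ ξ ∈ lineC ∩ translate ω '' lineC, height ξ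

/-- The number `2 ζ(3) / (3 ζ(2))`; the two zeta values are real. -/
noncomputable def eta : ℝ := 2 * (riemannZeta 3).re / (3 * (riemannZeta 2).re)

theorem mk_mem_lineC (v : Fin 3 → QBar) (hv : v ≠ 0) :
    (Projectivization.mk QBar v hv : Proj 2) ∈ lineC ↔ v 0 + v 1 + v 2 = 0 := by
  simp only [lineC, zeroSet, Set.mem_ofPred_eq, Projectivization.submodule_mk,
    Submodule.mem_span_singleton, map_add, MvPolynomial.eval_X]
  constructor
  · intro h
    exact h v ⟨1, one_smul _ v⟩
  · rintro h _ ⟨a, rfl⟩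
    simp only [Pi.smul_apply, smul_eq_mul]
    linear_combination a * h

theorem diagonal_apply_two (ω : Torus 2) (u : Fin 3 → QBar) :
    diagonal ω u = ![u 0, ω 0 * u 1, ω 1 * u 2] := by
  ext i
  fin_cases i
  · simp [diagonal, LinearEquiv.smulOfUnit]
  · simp [diagonal, LinearEquiv.smulOfUnit, Units.smul_def]
  · change ((Fin.cons 1 ω : Fin 3 → QBarˣ) 2) • u 2 = (ω 1 : QBar) * u 2
    rfl

theorem mk_mem_translate_lineC (ω : Torus 2) (v : Fin 3 → QBar) (hv : v ≠ 0) :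
    (Projectivization.mk QBar v hv : Proj 2) ∈ translate ω '' lineC ↔
      v 0 + (ω 0 : QBar)⁻¹ * v 1 + (ω 1 : QBar)⁻¹ * v 2 = 0 := by
  have w0 : (ω 0 : QBar) ≠ 0 := (ω 0).ne_zero
  have w1 : (ω 1 : QBar) ≠ 0 := (ω 1).ne_zero
  constructor
  · rintro ⟨ξ, hξ, h⟩
    induction ξ using Projectivization.ind with
    | h u hu =>
      rw [mk_mem_lineC] at hξ
      rw [translate, Projectivization.map_mk, Projectivization.mk_eq_mk_iff'] at h
      obtain ⟨a, ha⟩ := h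
      rw [LinearEquiv.coe_coe, diagonal_apply_two] at ha
      have ha0 : a ≠ 0 := by
        rintro rfl
        apply hu
        have h0 := congrFun ha 0
        have h1 := congrFun ha 1
        have h2 := congrFun ha 2
        simp [w0, w1] at h0 h1 h2
        ext i
        fin_cases i <;> simp [← h0, h1, h2]
      have h0 := congrFun ha 0
      have h1 := congrFun ha 1
      have h2 := congrFun ha 2
      simp at h0 h1 h2
      field_simp
      apply mul_left_cancel₀ ha0
      linear_combination (ω 0 : QBar) * ω 1 * hξ +
        (ω 0 : QBar) * ω 1 * h0 + (ω 1 : QBar) * h1 + (ω 0 : QBar) * h2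
  · intro h
    have hu : (![v 0, (ω 0 : QBar)⁻¹ * v 1, (ω 1 : QBar)⁻¹ * v 2] : Fin 3 → QBar) ≠ 0 := by
      intro h'
      apply hv
      have h0 := congrFun h' 0
      have h1 := congrFun h' 1
      have h2 := congrFun h' 2
      simp at h0 h1 h2
      ext i
      fin_cases i <;> simp [h0, h1, h2]
    refine ⟨Projectivization.mk QBar _ hu, ?_, ?_⟩
    · rw [mk_mem_lineC]
      simpa using h
    · rw [translate, Projectivization.map_mk, Projectivization.mk_eq_mk_iff']
      refine ⟨1, ?_⟩
      rw [LinearEquiv.coe_coe, diagonal_apply_two]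
      ext i
      fin_cases i <;> simp [w0, w1]

theorem lineC_inter_translate_eq_singleton (ω : Torus 2) (hω : ω ≠ 1) :
    ∃ hv : (![(ω 1 : QBar)⁻¹ - (ω 0 : QBar)⁻¹, 1 - (ω 1 : QBar)⁻¹, (ω 0 : QBar)⁻¹ - 1] :
        Fin 3 → QBar) ≠ 0,
      lineC ∩ translate ω '' lineC = {Projectivization.mk QBar _ hv} := by
  have hv : (![(ω 1 : QBar)⁻¹ - (ω 0 : QBar)⁻¹, 1 - (ω 1 : QBar)⁻¹, (ω 0 : QBar)⁻¹ - 1] :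
      Fin 3 → QBar) ≠ 0 := by
    intro h
    apply hω
    have h1 := congrFun h 1
    have h2 := congrFun h 2
    simp [sub_eq_zero] at h1 h2
    ext i
    fin_cases i
    · simpa using h2
    · simpa using h1
  refine ⟨hv, ?_⟩
  ext ξ
  induction ξ using Projectivization.ind with
  | h u hu =>
    rw [Set.mem_inter_iff, mk_mem_lineC, mk_mem_translate_lineC, Set.mem_singleton_iff,
      Projectivization.mk_eq_mk_iff']
    generalize (ω 0 : QBar)⁻¹ = a at hv ⊢
    generalize (ω 1 : QBar)⁻¹ = b at hv ⊢
    constructor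
    · rintro ⟨h1, h2⟩
      by_cases ha : a = 1
      · have hb : 1 - b ≠ 0 := by
          intro hb
          apply hv
          have hb' : b = 1 := by linear_combination -hb
          subst ha hb'
          ext i
          fin_cases i <;> simp
        refine ⟨u 1 / (1 - b), ?_⟩
        subst ha
        have h3 : u 2 = 0 := by
          apply mul_left_cancel₀ hb
          linear_combination h1 - h2
        have h4 : u 0 = - u 1 := by linear_combination h1 - h3
        ext i
        fin_cases i <;> simp [h3, h4] <;> field_simp <;> ring
      · have ha' : a - 1 ≠ 0 := sub_ne_zero.mpr ha
        refine ⟨u 2 / (a - 1), ?_⟩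
        ext i
        fin_cases i
        · simp
          field_simp
          linear_combination h2 - a * h1
        · simp
          field_simp
          linear_combination h1 - h2
        · simp
          field_simp
    · rintro ⟨c, rfl⟩
      constructor <;> simp <;> ring

end TorusHeight

/-!
Write `a`, `b` for the inverses of the coordinates of a torsion point `ω ≠ 1`. The curves meet in
the point `[b - a : 1 - b : a - 1]`. If `z` is a root of unity generating the group generated by
`a` and `b`, the ideal generated by the coordinates is the one generated by `1 - z`, so that the
finite places contribute `-log N(1 - z)` to the height, which is `-log Φ_d(1) / φ(d)` after
normalisation, `d` being the order of `z`, and is negligible for large `d`. The infinite places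
contribute the average, over the Galois orbit of `(a, b)`, of the logarithm of the longest side of
the triangle with vertices `1`, `a`, `b` on the unit circle (`orbitAvg_sub_le_interHeight`).

Such orbits are equidistributed: the average of a character is the normalised Ramanujan sum
`μ(e) / φ(e)`, with `e` the order of the value of the character at `ω`, and it tends to zero as `e → ∞`
(`IsGenericTorsion.tendsto_orbitAvg`). The test function has a logarithmic singularity at the
identity, where it is bounded below by `log |1 - x|`. The average of the latter over an orbit is
`log Φ_e(1) / φ(e) ≥ 0` and its integral is zero, so a cutoff of the singularity has a uniformly
small effect (`IsGenericTorsion.tendsto_orbitAvg_log_side`).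

It remains to integrate the logarithm of the longest side over the compact torus. By symmetry this
is three times the integral over the set where a given side is the longest, that is, three times
`∫ log (2 sin (π ‖u‖)) w(‖u‖) du` with `w(r) = r + max(0, 3 r - 1)` (`volume_lens`). The Fourier
series of `w` is a combination of those of the periodic second Bernoulli function at `r`, `2 r`
and `3 r`, and the Fourier coefficients of `log (2 sin (π t))` are classical; the integral is
`4 ζ(3) / π ^ 2` (`integral_log_torusSide`).

A strict sequence of sets defines a filter on the torus, consisting of the sets of asymptotic
density one. Strictness, applied to kernels of characters, says that the order of every nontrivial
character tends to infinity along this filter (`IsStrict.isGenericTorsion`), so the height tends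
to `eta` along it. This is the first claim; the second one follows because the heights are
bounded.
-/

namespace TorusHeight

/-! ### Averages over the embeddings of a number field -/

/-- The factor `2` is only needed at the prime `2`: the sharper bound for odd numbers makes the
statement multiplicative. -/
theorem le_two_mul_totient_sq (n : ℕ) :
    (Odd n → n ≤ n.totient ^ 2) ∧ n ≤ 2 * n.totient ^ 2 := by
  induction n using Nat.recOnPosPrimePosCoprime with
  | zero => simp
  | one => simp
  | prime_pow p k hp hk =>
    obtain ⟨k, rfl⟩ : ∃ j, k = j + 1 := ⟨k - 1, by omega⟩
    rw [Nat.totient_prime_pow_succ hp]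
    have h1 : 1 ≤ p ^ k := Nat.one_le_pow _ _ hp.pos
    obtain ⟨q, rfl⟩ : ∃ q, p = q + 1 := ⟨p - 1, by have := hp.pos; omega⟩
    rw [Nat.add_sub_cancel]
    have h2 : (q + 1) ^ k * (q + 1) ≤ (q + 1) ^ k * (q + 1) ^ k * (q + 1) := by
      gcongr; nlinarith
    have hq : 1 ≤ q := by have := hp.two_le; omega
    constructor
    · intro hodd
      have hq2 : 2 ≤ q := by
        rcases Nat.lt_or_ge q 2 with h | h
        · have : q = 1 := by omega
          subst this
          simp [Nat.odd_iff, pow_succ] at hodd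
        · exact h
      calc (q + 1) ^ (k + 1) = (q + 1) ^ k * (q + 1) := pow_succ _ _
        _ ≤ (q + 1) ^ k * (q + 1) ^ k * (q + 1) := h2
        _ ≤ (q + 1) ^ k * (q + 1) ^ k * q ^ 2 := by gcongr; nlinarith
        _ = _ := by ring
    · calc (q + 1) ^ (k + 1) = (q + 1) ^ k * (q + 1) := pow_succ _ _
        _ ≤ (q + 1) ^ k * (q + 1) ^ k * (q + 1) := h2
        _ ≤ (q + 1) ^ k * (q + 1) ^ k * (2 * q ^ 2) := by gcongr; nlinarith
        _ = _ := by ring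
  | coprime a b ha hb hab iha ihb =>
    rw [Nat.totient_mul hab]
    refine ⟨fun h => ?_, ?_⟩
    · rw [Nat.odd_mul] at h
      rw [mul_pow]
      exact Nat.mul_le_mul (iha.1 h.1) (ihb.1 h.2)
    · rcases Nat.even_or_odd a with h | h
      · have hb' : Odd b := by
          rcases Nat.even_or_odd b with h' | h'
          · exact absurd hab (Nat.not_coprime_of_dvd_of_dvd one_lt_two h.two_dvd h'.two_dvd)
          · exact h'
        calc a * b ≤ (2 * a.totient ^ 2) * b.totient ^ 2 := Nat.mul_le_mul iha.2 (ihb.1 hb')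
          _ = _ := by ring
      · calc a * b ≤ a.totient ^ 2 * (2 * b.totient ^ 2) := Nat.mul_le_mul (iha.1 h) ihb.2
          _ = _ := by ring

theorem tendsto_totient_atTop : Tendsto Nat.totient atTop atTop := by
  refine tendsto_atTop.2 fun B => ?_
  filter_upwards [eventually_ge_atTop (2 * B ^ 2)] with n hn
  by_contra! h
  have := (le_two_mul_totient_sq n).2
  have h2 : n.totient ^ 2 < B ^ 2 := Nat.pow_lt_pow_left h two_ne_zero
  omega

/-- The sum of the primitive `n`-th roots of unity is the Möbius function of `n`. -/
theorem sum_primitiveRoots_eq_moebius {n : ℕ} (hn : 0 < n) :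
    ∑ z ∈ primitiveRoots n ℂ, z = ((ArithmeticFunction.moebius n : ℤ) : ℂ) := by
  have key := (ArithmeticFunction.sum_eq_iff_sum_mul_moebius_eq (R := ℂ)
    (f := fun n => ∑ z ∈ primitiveRoots n ℂ, z) (g := fun n => if n = 1 then 1 else 0)).1 ?_ n hn
  · rw [← key, Finset.sum_eq_single (n, 1)]
    · simp
    · rintro ⟨a, b⟩ hab hne
      have := (Nat.mem_divisorsAntidiagonal.1 hab).1
      have hb : b ≠ 1 := by rintro rfl; simp at this; simp [this] at hne
      simp [hb]
    · simp [hn.ne']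
  · intro m hm
    have hprim := Complex.isPrimitiveRoot_exp m hm.ne'
    have : NeZero m := ⟨hm.ne'⟩
    have hdisj : Set.PairwiseDisjoint (m.divisors : Set ℕ) fun d => primitiveRoots d ℂ :=
      fun k _ l _ hkl => IsPrimitiveRoot.disjoint hkl
    rw [← Finset.sum_biUnion hdisj, ← IsPrimitiveRoot.nthRoots_one_eq_biUnion_primitiveRoots]
    have himg : Polynomial.nthRootsFinset m (1 : ℂ) =
        (Finset.range m).image (fun i => Complex.exp (2 * Real.pi * Complex.I / m) ^ i) := by
      ext w
      simp only [Polynomial.mem_nthRootsFinset hm, Finset.mem_image, Finset.mem_range]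
      constructor
      · intro h
        obtain ⟨i, hi, rfl⟩ := hprim.eq_pow_of_pow_eq_one h
        exact ⟨i, hi, rfl⟩
      · rintro ⟨i, -, rfl⟩
        rw [pow_right_comm, hprim.pow_eq_one, one_pow]
    rw [himg, Finset.sum_image fun i hi j hj h => hprim.pow_inj (by simpa using hi)
      (by simpa using hj) h]
    rcases Nat.lt_or_ge 1 m with h1 | h1
    · rw [hprim.geom_sum_eq_zero h1, if_neg h1.ne']
    · obtain rfl : m = 1 := by omega
      simp

/-- The average of a function over the complex embeddings of a number field. -/
noncomputable def embAvg (L : Type*) [Field L] [NumberField L] {E : Type*} [AddCommGroup E] [Module ℝ E]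
    (f : (L →ₐ[ℚ] ℂ) → E) : E :=
  (Module.finrank ℚ L : ℝ)⁻¹ • ∑ σ, f σ

section
variable {K L : Type*} [Field K] [NumberField K] [Field L] [NumberField L]

/-- Every embedding of `K` has `[L : K]` extensions to `L`. -/
theorem sum_embeddings_restrict [Algebra K L] {E : Type*} [AddCommGroup E] (f : (K →ₐ[ℚ] ℂ) → E) :
    ∑ σ : L →ₐ[ℚ] ℂ, f (σ.comp (IsScalarTower.toAlgHom ℚ K L)) =
      Module.finrank K L • ∑ τ, f τ := by
  classical
  rw [Fintype.sum_equiv (algHomEquivSigma (A := ℚ) (B := K) (C := L) (D := ℂ))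
      (fun σ => f (σ.comp (IsScalarTower.toAlgHom ℚ K L))) (fun s => f s.1) fun σ => rfl,
    ← Finset.univ_sigma_univ, Finset.sum_sigma, Finset.smul_sum]
  refine Finset.sum_congr rfl fun τ _ => ?_
  let := τ.toRingHom.toAlgebra
  change ∑ _s : L →ₐ[K] ℂ, f τ = _
  rw [Finset.sum_const, Finset.card_univ]
  congr 1
  exact AlgHom.card K L ℂ

variable {E : Type*} [AddCommGroup E] [Module ℝ E]

theorem embAvg_restrict [Algebra K L] (f : (K →ₐ[ℚ] ℂ) → E) :
    embAvg L (fun σ => f (σ.comp (IsScalarTower.toAlgHom ℚ K L))) = embAvg K f := by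
  rw [embAvg, sum_embeddings_restrict, embAvg, ← Module.finrank_mul_finrank ℚ K L,
    ← Nat.cast_smul_eq_nsmul ℝ, smul_smul]
  congr 1
  have : (Module.finrank K L : ℝ) ≠ 0 := by
    exact_mod_cast (Module.finrank_pos).ne'
  push_cast
  field_simp

open IntermediateField in
/-- The conjugates of a primitive `n`-th root of unity are all the primitive `n`-th roots of unity,
by irreducibility of the cyclotomic polynomial. -/
theorem embAvg_primitiveRoot {z : L} {n : ℕ} (hn : 0 < n) (hz : IsPrimitiveRoot z n) (f : ℂ → E) :
    embAvg L (fun σ => f (σ z)) = (n.totient : ℝ)⁻¹ • ∑ w ∈ primitiveRoots n ℂ, f w := by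
  classical
  have hint : IsIntegral ℚ z := Algebra.IsIntegral.isIntegral z
  have h0 := embAvg_restrict (K := ℚ⟮z⟯) (L := L) (fun τ => f (τ (AdjoinSimple.gen ℚ z)))
  change embAvg L (fun σ => f (σ z)) = _ at h0
  have hmin : minpoly ℚ z = Polynomial.cyclotomic n ℚ :=
    (Polynomial.cyclotomic_eq_minpoly_rat hz hn).symm
  have hfin : Module.finrank ℚ ℚ⟮z⟯ = n.totient := by
    rw [adjoin.finrank hint, hmin, Polynomial.natDegree_cyclotomic]
  have hgen : IsPrimitiveRoot (AdjoinSimple.gen ℚ z) n :=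
    IsPrimitiveRoot.of_map_of_injective (f := algebraMap ℚ⟮z⟯ L)
      (by rw [AdjoinSimple.algebraMap_gen]; exact hz) (algebraMap ℚ⟮z⟯ L).injective
  have : NeZero n := ⟨hn.ne'⟩
  rw [h0, embAvg, hfin]
  congr 1
  refine Finset.sum_bij (fun τ _ => τ (AdjoinSimple.gen ℚ z)) (fun τ _ => ?_)
    (fun τ _ τ' _ h => ?_) (fun w hw => ?_) fun _ _ => rfl
  · exact (mem_primitiveRoots hn).2 (hgen.map_of_injective τ.injective)
  · exact (adjoin.powerBasis hint).algHom_ext (by rw [adjoin.powerBasis_gen]; exact h)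
  · have hw' : w ∈ (minpoly ℚ z).aroots ℂ := by
      rw [Polynomial.mem_aroots, hmin]
      refine ⟨Polynomial.cyclotomic_ne_zero n ℚ, ?_⟩
      rw [Polynomial.aeval_def, ← Polynomial.eval_map, Polynomial.map_cyclotomic]
      exact (Polynomial.isRoot_cyclotomic_iff).2 ((mem_primitiveRoots hn).1 hw)
    exact ⟨(algHomAdjoinIntegralEquiv ℚ hint).symm ⟨w, hw'⟩, Finset.mem_univ _,
      algHomAdjoinIntegralEquiv_symm_apply_gen ℚ hint ⟨w, hw'⟩⟩

/-- The average is `log Φₙ(1) / φ(n)`, where `Φₙ(1)` is `p` if `n` is a power of a prime `p`, and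
`1` otherwise. -/
theorem embAvg_log_norm_one_sub {z : L} {n : ℕ} (hn : 2 ≤ n) (hz : IsPrimitiveRoot z n) :
    0 ≤ embAvg L (fun σ => Real.log ‖1 - σ z‖) ∧
      embAvg L (fun σ => Real.log ‖1 - σ z‖) ≤ 2 * (Real.log n / n) := by
  have hn0 : 0 < n := by omega
  rw [embAvg_primitiveRoot (f := fun w => Real.log ‖1 - w‖) hn0 hz]
  have hne : ∀ w ∈ primitiveRoots n ℂ, ‖1 - w‖ ≠ 0 := by
    intro w hw h
    rw [norm_eq_zero, sub_eq_zero] at h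
    have h1 := (mem_primitiveRoots hn0).1 hw
    rw [← h] at h1
    have := h1.unique IsPrimitiveRoot.one
    omega
  rw [← Real.log_prod hne, ← norm_prod]
  have hev : ∏ w ∈ primitiveRoots n ℂ, (1 - w) = (Polynomial.cyclotomic n ℂ).eval 1 := by
    rw [Polynomial.cyclotomic_eq_prod_X_sub_primitiveRoots (Complex.isPrimitiveRoot_exp n hn0.ne'),
      Polynomial.eval_prod]
    simp
  rw [hev]
  have hlog : 0 ≤ Real.log n := Real.log_natCast_nonneg n
  by_cases hpp : ∃ p k : ℕ, p.Prime ∧ n = p ^ (k + 1)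
  · obtain ⟨p, k, hp, rfl⟩ := hpp
    have : Fact p.Prime := ⟨hp⟩
    rw [Polynomial.eval_one_cyclotomic_prime_pow, Complex.norm_natCast, smul_eq_mul]
    have hp2 : (2 : ℝ) ≤ p := by exact_mod_cast hp.two_le
    have hlp : 0 ≤ Real.log p := Real.log_natCast_nonneg p
    refine ⟨by positivity, ?_⟩
    rw [Nat.totient_prime_pow_succ hp, ← div_eq_inv_mul]
    push_cast [Nat.cast_sub hp.one_le]
    have hlp' : Real.log p ≤ Real.log ((p : ℝ) ^ (k + 1)) := by
      rw [Real.log_pow]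
      push_cast
      nlinarith [(Nat.cast_nonneg k : (0 : ℝ) ≤ k)]
    have h1 : (0 : ℝ) < (p : ℝ) ^ k := by positivity
    rw [← mul_div_assoc, div_le_div_iff₀ (by nlinarith) (by positivity)]
    have h2 : (p : ℝ) ^ (k + 1) ≤ 2 * ((p : ℝ) ^ k * (p - 1)) := by
      rw [pow_succ]; nlinarith
    calc _ ≤ Real.log ((p : ℝ) ^ (k + 1)) * (2 * ((p : ℝ) ^ k * (p - 1))) := by
          gcongr
          exact hlp.trans hlp'
      _ = _ := by ring
  · rw [Polynomial.eval_one_cyclotomic_not_prime_pow]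
    · simp only [norm_one, Real.log_one, smul_zero]
      exact ⟨le_rfl, by positivity⟩
    · intro p hp k h
      rcases k with _ | k
      · simp at h; omega
      · exact hpp ⟨p, k, hp, h.symm⟩

/-- The average is `μ(n) / φ(n)`. -/
theorem norm_embAvg_root_le {z : L} {n : ℕ} (hn : 0 < n) (hz : IsPrimitiveRoot z n) :
    ‖embAvg L (fun σ => σ z)‖ ≤ (n.totient : ℝ)⁻¹ := by
  rw [embAvg_primitiveRoot (f := fun w => w) hn hz, sum_primitiveRoots_eq_moebius hn, norm_smul]
  have h1 : ‖((ArithmeticFunction.moebius n : ℤ) : ℂ)‖ ≤ 1 := by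
    rw [Complex.norm_intCast]
    exact_mod_cast ArithmeticFunction.abs_moebius_le_one
  rw [Real.norm_of_nonneg (by positivity)]
  exact mul_le_of_le_one_right (by positivity) h1
end

/-! ### Heights and ideals of integral vectors -/

section
open NumberField Height
variable {K L : Type*} [Field K] [NumberField K] [Field L] [NumberField L]

/-- A sum over the infinite places, weighted by local degrees, is a sum over complex embeddings. -/
theorem sum_infinitePlace_mult_mul (g : (L → ℝ) → ℝ) :
    ∑ v : InfinitePlace L, v.mult * g v = ∑ σ : L →ₐ[ℚ] ℂ, g (fun z => ‖σ z‖) := by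
  classical
  have h1 : ∑ σ : L →ₐ[ℚ] ℂ, g (fun z => ‖σ z‖) = ∑ φ : L →+* ℂ, g (InfinitePlace.mk φ) :=
    Fintype.sum_equiv (RingHom.equivRatAlgHom L ℂ).symm _ _ fun σ => rfl
  rw [h1, ← Finset.sum_fiberwise (s := Finset.univ) (g := fun φ : L →+* ℂ => InfinitePlace.mk φ)]
  refine Finset.sum_congr rfl fun v _ => ?_
  rw [Finset.sum_congr rfl (g := fun _ => g v), Finset.sum_const, InfinitePlace.card_filter_mk_eq,
    nsmul_eq_mul]
  intro φ hφ
  rw [(Finset.mem_filter.1 hφ).2]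

/-- The height of a vector of algebraic integers: the finite places contribute
minus the logarithm of the norm of the ideal generated by the coordinates. -/
theorem logHeight_integral {ι : Type*} [Finite ι] (x : ι → 𝓞 L) (hx : x ≠ 0) :
    logHeight (fun i => (x i : L)) = ∑ σ : L →ₐ[ℚ] ℂ, Real.log (⨆ i, ‖σ (x i)‖) -
      Real.log (Ideal.absNorm (Ideal.span (Set.range x))) := by
  have hx' : (fun i => (x i : L)) ≠ 0 := by
    obtain ⟨i, hi⟩ := Function.ne_iff.1 hx
    exact Function.ne_iff.2 ⟨i, by simpa using hi⟩
  have hfin := absNorm_mul_finprod_finitePlace_eq_one hx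
  have hN : (Ideal.absNorm (Ideal.span (Set.range x)) : ℝ) ≠ 0 := left_ne_zero_of_mul_eq_one hfin
  have hfin' : ∏ᶠ v : FinitePlace L, ⨆ i, v (x i : L) =
      (Ideal.absNorm (Ideal.span (Set.range x)) : ℝ)⁻¹ := (inv_eq_of_mul_eq_one_right hfin).symm
  obtain ⟨i, hi⟩ := Function.ne_iff.1 hx'
  have hpos : ∀ v : InfinitePlace L, 0 < ⨆ i, v (x i : L) := fun v =>
    (v.pos_iff.2 hi).trans_le (Finite.le_ciSup (fun i => v (x i : L)) i)
  rw [logHeight_eq_log_mulHeight, NumberField.mulHeight_eq hx', hfin',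
    Real.log_mul _ (inv_ne_zero hN),
    Real.log_inv, ← sub_eq_add_neg, Real.log_prod]
  · congr 1
    rw [← sum_infinitePlace_mult_mul (fun a => Real.log (⨆ i, a (x i : L)))]
    exact Finset.sum_congr rfl fun v _ => Real.log_pow _ _
  · exact fun v _ => pow_ne_zero _ (hpos v).ne'
  · exact Finset.prod_ne_zero_iff.2 fun v _ => pow_ne_zero _ (hpos v).ne'

/-- The height relative to a number field is multiplied by the degree in an extension. -/
theorem logHeight_algebraMap [Algebra K L] {ι : Type*} [Finite ι] (x : ι → K) (hx : x ≠ 0) :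
    logHeight (fun i => algebraMap K L (x i)) = Module.finrank K L * logHeight x := by
  obtain ⟨c, hc⟩ := IsLocalization.exist_integer_multiples_of_finite (nonZeroDivisors (𝓞 K)) x
  choose y hy using hc
  have hc0 : ((c : 𝓞 K) : K) ≠ 0 := by
    simp
  have hy' : ∀ i, (y i : K) = (c : 𝓞 K) * x i := fun i => by
    rw [← Algebra.smul_def]
    exact hy i
  have hy0 : y ≠ 0 := by
    obtain ⟨i, hi⟩ := Function.ne_iff.1 hx
    refine Function.ne_iff.2 ⟨i, fun h => ?_⟩
    have := hy' i
    rw [h] at this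
    simp at this hi
    tauto
  have e1 : logHeight x = logHeight (fun i => (y i : K)) := by
    rw [← logHeight_smul_eq_logHeight x hc0]
    congr 1; ext i; simp [hy']
  let y' : ι → 𝓞 L := fun i => algebraMap (𝓞 K) (𝓞 L) (y i)
  have hy'0 : y' ≠ 0 := by
    obtain ⟨i, hi⟩ := Function.ne_iff.1 hy0
    refine Function.ne_iff.2 ⟨i, ?_⟩
    simpa [y'] using hi
  have hmap : ∀ i, ((y' i : 𝓞 L) : L) = algebraMap K L (y i) := fun i => rfl
  have e2 : logHeight (fun i => algebraMap K L (x i)) = logHeight (fun i => (y' i : L)) := by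
    rw [← logHeight_smul_eq_logHeight (fun i => algebraMap K L (x i))
      (c := algebraMap K L (c : 𝓞 K)) (by simp)]
    congr 1; ext i; simp [hmap, hy']
  have hspan : Ideal.span (Set.range y') =
      (Ideal.span (Set.range y)).map (algebraMap (𝓞 K) (𝓞 L)) := by
    rw [Ideal.map_span, ← Set.range_comp]; rfl
  have hrank : Module.finrank (𝓞 K) (𝓞 L) = Module.finrank K L :=
    (IsFractionRing.finrank_eq (𝓞 K) K (𝓞 L) L).symm
  rw [e1, e2, logHeight_integral y hy0, logHeight_integral y' hy'0, hspan,
    Ideal.absNorm_algebraMap, Nat.cast_pow, Real.log_pow, hrank, mul_sub,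
    ← nsmul_eq_mul (Module.finrank K L) (∑ σ : K →ₐ[ℚ] ℂ, _),
    ← sum_embeddings_restrict (fun τ => Real.log (⨆ i, ‖τ (y i : K)‖))]
  rfl

/-- The length of the longest side of the triangle with vertices `1`, `x`, `y`. -/
noncomputable def side (x y : ℂ) : ℝ := max ‖1 - x‖ (max ‖1 - y‖ ‖x - y‖)

theorem iSup_norm_sub (x y : ℂ) : ⨆ i, ‖(![y - x, 1 - y, x - 1] : Fin 3 → ℂ) i‖ = side x y := by
  apply le_antisymm
  · refine ciSup_le fun i => ?_
    fin_cases i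
    · simp [side, norm_sub_rev y x]
    · simp [side]
    · simp [side, norm_sub_rev x 1]
  · have h := fun i => Finite.le_ciSup (fun i => ‖(![y - x, 1 - y, x - 1] : Fin 3 → ℂ) i‖) i
    refine max_le ?_ (max_le ?_ ?_)
    · simpa [norm_sub_rev x 1] using h 2
    · exact h 1
    · simpa [norm_sub_rev y x] using h 0

/-- If `z` generates the group generated by `a` and `b`, the ideal generated by
`b - a`, `1 - b`, `a - 1` is generated by `1 - z`. -/
theorem span_sub_eq {R : Type*} [CommRing R] (z : R) (i j : ℕ) (m n : ℕ)
    (hz : z = (z ^ i) ^ m * (z ^ j) ^ n) :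
    Ideal.span (Set.range ![z ^ j - z ^ i, 1 - z ^ j, z ^ i - 1]) = Ideal.span {1 - z} := by
  apply le_antisymm
  · have hdvd : ∀ k : ℕ, 1 - z ∣ 1 - z ^ k := fun k => by
      simpa using sub_dvd_pow_sub_pow 1 z k
    rw [Ideal.span_le]
    rintro _ ⟨k, rfl⟩
    rw [SetLike.mem_coe, Ideal.mem_span_singleton]
    fin_cases k
    · have := dvd_sub (hdvd i) (hdvd j)
      simpa using this
    · exact hdvd j
    · have := (hdvd i).neg_right
      simpa using! this
  · rw [Ideal.span_singleton_le_iff_mem]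
    have ha : 1 - z ^ i ∈ Ideal.span (Set.range ![z ^ j - z ^ i, 1 - z ^ j, z ^ i - 1]) := by
      have : z ^ i - 1 ∈ Ideal.span (Set.range ![z ^ j - z ^ i, 1 - z ^ j, z ^ i - 1]) :=
        Ideal.subset_span ⟨2, rfl⟩
      simpa using neg_mem this
    have hb : 1 - z ^ j ∈ Ideal.span (Set.range ![z ^ j - z ^ i, 1 - z ^ j, z ^ i - 1]) :=
      Ideal.subset_span ⟨1, rfl⟩
    obtain ⟨c, hc⟩ : 1 - z ^ i ∣ 1 - (z ^ i) ^ m := by simpa using sub_dvd_pow_sub_pow 1 (z ^ i) m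
    obtain ⟨d, hd⟩ : 1 - z ^ j ∣ 1 - (z ^ j) ^ n := by simpa using sub_dvd_pow_sub_pow 1 (z ^ j) n
    have : 1 - z = c * (1 - z ^ i) + (z ^ i) ^ m * d * (1 - z ^ j) := by
      conv_lhs => rw [hz]
      linear_combination hc + (z ^ i) ^ m * hd
    rw [this]
    exact add_mem (Ideal.mul_mem_left _ _ ha) (Ideal.mul_mem_left _ _ hb)

/-- The height of a one-coordinate vector is zero, by the product formula. -/
theorem log_absNorm_span_singleton (x : 𝓞 L) (hx : x ≠ 0) :
    Real.log (Ideal.absNorm (Ideal.span {x})) = ∑ σ : L →ₐ[ℚ] ℂ, Real.log ‖σ x‖ := by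
  have h := logHeight_integral (ι := Unit) (fun _ => x) (fun h => hx (congrFun h ()))
  rw [logHeight_eq_zero_of_subsingleton] at h
  simp only [ciSup_const, Set.range_const] at h
  linarith

/-- The height of `[b - a : 1 - b : a - 1]`, for roots of unity `a = z ^ i` and `b = z ^ j`
generating the same group as `z`. The finite places contribute the average of `log |1 - σ z|`, the
ideal generated by the coordinates being the one generated by `1 - z`. -/
theorem logHeight_rootsOfUnity {z : L} {d : ℕ} (hd : 2 ≤ d) (hz : IsPrimitiveRoot z d)
    (i j m n : ℕ) (hmn : z = (z ^ i) ^ m * (z ^ j) ^ n) :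
    logHeight ![z ^ j - z ^ i, 1 - z ^ j, z ^ i - 1] =
      Module.finrank ℚ L * (embAvg L (fun σ => Real.log (side (σ (z ^ i)) (σ (z ^ j)))) -
        embAvg L (fun σ => Real.log ‖1 - σ z‖)) := by
  let y : 𝓞 L := ⟨z, hz.isIntegral (by omega)⟩
  have hy1 : (1 : 𝓞 L) - y ≠ 0 := by
    intro h
    have h1 : 1 - z = 0 := congrArg (algebraMap (𝓞 L) L) h
    exact hz.ne_one (by omega) (by linear_combination -h1)
  have hmn' : y = (y ^ i) ^ m * (y ^ j) ^ n := RingOfIntegers.ext hmn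
  have hspan := span_sub_eq y i j m n hmn'
  have hx0 : ![y ^ j - y ^ i, 1 - y ^ j, y ^ i - 1] ≠ 0 := by
    intro h
    rw [h] at hspan
    have : Ideal.span {1 - y} = ⊥ := by rw [← hspan]; simp
    simp [hy1] at this
  have key := logHeight_integral _ hx0
  rw [hspan, log_absNorm_span_singleton _ hy1] at key
  have e1 : (fun k => ((![y ^ j - y ^ i, 1 - y ^ j, y ^ i - 1] k : 𝓞 L) : L)) =
      ![z ^ j - z ^ i, 1 - z ^ j, z ^ i - 1] := by
    ext k; fin_cases k <;> rfl
  have e2 : ∀ σ : L →ₐ[ℚ] ℂ,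
      (⨆ k, ‖σ ((![y ^ j - y ^ i, 1 - y ^ j, y ^ i - 1] k : 𝓞 L) : L)‖) =
        side (σ (z ^ i)) (σ (z ^ j)) := by
    intro σ
    rw [← iSup_norm_sub]
    congr 1; ext k
    rw [show ((![y ^ j - y ^ i, 1 - y ^ j, y ^ i - 1] k : 𝓞 L) : L) =
      ![z ^ j - z ^ i, 1 - z ^ j, z ^ i - 1] k from congrFun e1 k]
    fin_cases k <;> simp
  have e3 : ∀ σ : L →ₐ[ℚ] ℂ, ‖σ ((1 - y : 𝓞 L) : L)‖ = ‖1 - σ z‖ := by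
    intro σ
    rw [show ((1 - y : 𝓞 L) : L) = 1 - z from rfl, map_sub, map_one]
  simp only [e1, e2, e3] at key
  have hL : (Module.finrank ℚ L : ℝ) ≠ 0 := by exact_mod_cast (Module.finrank_pos).ne'
  rw [key, embAvg, embAvg, smul_eq_mul, smul_eq_mul, mul_sub, mul_inv_cancel_left₀ hL,
    mul_inv_cancel_left₀ hL]
end

/-! ### The height of the intersection point -/

/-- Two roots of unity are powers of a root of unity in the group that they generate. -/
theorem exists_primitiveRoot_pair {L : Type*} [Field L] {a b : Lˣ} (ha : IsOfFinOrder a)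
    (hb : IsOfFinOrder b) :
    ∃ (z : L) (d i j m n : ℕ), 0 < d ∧ IsPrimitiveRoot z d ∧ (a : L) = z ^ i ∧ (b : L) = z ^ j ∧
      z = (z ^ i) ^ m * (z ^ j) ^ n := by
  obtain ⟨N, hN, haN⟩ := isOfFinOrder_iff_pow_eq_one.1 ha
  obtain ⟨M, hM, hbM⟩ := isOfFinOrder_iff_pow_eq_one.1 hb
  have : NeZero (N * M) := ⟨(Nat.mul_pos hN hM).ne'⟩
  let a' : rootsOfUnity (N * M) L := ⟨a, by rw [mem_rootsOfUnity, pow_mul, haN, one_pow]⟩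
  let b' : rootsOfUnity (N * M) L := ⟨b, by rw [mem_rootsOfUnity, mul_comm, pow_mul, hbM, one_pow]⟩
  let H : Subgroup (rootsOfUnity (N * M) L) := Subgroup.closure {a', b'}
  obtain ⟨g, hg⟩ := IsCyclic.exists_generator (α := H)
  have hgH : (g : rootsOfUnity (N * M) L) ∈ Subgroup.closure {a', b'} := g.2
  obtain ⟨p, q, hpq⟩ := Subgroup.mem_closure_pair.1 hgH
  have hpow : ∀ {G : Type _} [Group G] [Finite G] (x y : G), y ∈ Subgroup.zpowers x →
      ∃ n : ℕ, x ^ n = y := fun x y h => by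
    rw [← mem_powers_iff_mem_zpowers] at h
    exact h
  obtain ⟨i, hi⟩ := hpow g ⟨a', Subgroup.subset_closure (by simp)⟩ (hg _)
  obtain ⟨j, hj⟩ := hpow g ⟨b', Subgroup.subset_closure (by simp)⟩ (hg _)
  obtain ⟨m, hm⟩ := hpow a' (a' ^ p) ⟨p, rfl⟩
  obtain ⟨n, hn⟩ := hpow b' (b' ^ q) ⟨q, rfl⟩
  let f : H →* L := (Units.coeHom L).comp ((rootsOfUnity (N * M) L).subtype.comp H.subtype)
  have hf : Function.Injective f := fun x y h =>
    Subtype.ext (Subtype.ext (Units.ext h))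
  have hai : (a : L) = f g ^ i := by rw [← map_pow, hi]; rfl
  have hbj : (b : L) = f g ^ j := by rw [← map_pow, hj]; rfl
  refine ⟨f g, orderOf g, i, j, m, n, orderOf_pos g,
    (IsPrimitiveRoot.orderOf g).map_of_injective hf, hai, hbj, ?_⟩
  rw [← hai, ← hbj]
  have : (g : rootsOfUnity (N * M) L) = a' ^ m * b' ^ n := by rw [hm, hn, hpq]
  exact congrArg (fun x : rootsOfUnity (N * M) L => ((x : Lˣ) : L)) this

/-- The number field generated by the coordinates of a point of the torus. -/
noncomputable def torusField (ω : Torus 2) : IntermediateField ℚ QBar :=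
  IntermediateField.adjoin ℚ {(ω 0 : QBar), (ω 1 : QBar)}

instance torusField_numberField (ω : Torus 2) : NumberField (torusField ω) := by
  have : FiniteDimensional ℚ (torusField ω) :=
    IntermediateField.finiteDimensional_adjoin fun x _ =>
      (Algebra.IsAlgebraic.isAlgebraic x).isIntegral
  exact ⟨⟩

/-- The inverses of the coordinates of a point of the torus, in the field they generate. -/
noncomputable def invCoord (ω : Torus 2) (i : Fin 2) : torusField ω :=
  ⟨(ω i : QBar)⁻¹, inv_mem (IntermediateField.subset_adjoin ℚ _ (by fin_cases i <;> simp))⟩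

/-- The average of a function over the Galois conjugates of the inverse of a point of the torus,
the conjugates being taken in `ℂ`. -/
noncomputable def orbitAvg (ω : Torus 2) {E : Type*} [AddCommGroup E] [Module ℝ E]
    (f : ℂ → ℂ → E) : E :=
  embAvg (torusField ω) fun σ => f (σ (invCoord ω 0)) (σ (invCoord ω 1))

/-- Up to the small contribution of the finite places, the height of the intersection point is the
average over a Galois orbit of the logarithm of the longest side of a triangle. -/
theorem orbitAvg_sub_le_interHeight {ω : Torus 2} (hω : IsOfFinOrder ω) (h1 : ω ≠ 1) :
    ∃ d : ℕ, 2 ≤ d ∧ orderOf (ω 0) ≤ d ∧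
      orbitAvg ω (fun x y => Real.log (side x y)) - 2 * (Real.log d / d) ≤ interHeight ω ∧
      interHeight ω ≤ orbitAvg ω (fun x y => Real.log (side x y)) := by
  obtain ⟨hv, hsing⟩ := lineC_inter_translate_eq_singleton ω h1
  set v : Fin 3 → QBar := ![(ω 1 : QBar)⁻¹ - (ω 0 : QBar)⁻¹, 1 - (ω 1 : QBar)⁻¹,
    (ω 0 : QBar)⁻¹ - 1] with hvdef
  have hinter : interHeight ω = height (Projectivization.mk QBar v hv : Proj 2) := by
    rw [interHeight, hsing, finsum_mem_singleton]
  obtain ⟨c, hc⟩ := (Projectivization.mk_eq_mk_iff' QBar _ _ (Projectivization.rep_nonzero _) hv).1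
    (Projectivization.mk_rep (Projectivization.mk QBar v hv : Proj 2))
  set r := (Projectivization.mk QBar v hv : Proj 2).rep with hr
  have hr0 : r ≠ 0 := Projectivization.rep_nonzero _
  have hc0 : c ≠ 0 := by rintro rfl; exact hr0 (by rw [← hc, zero_smul])
  -- The height is computed in the field generated by the chosen representative `r`, which need
  -- not contain the root of unity `z` below; both are contained in `L`.
  let K := coordField r
  let T := torusField ω
  let L : IntermediateField ℚ QBar := K ⊔ T
  have : FiniteDimensional ℚ K := NumberField.to_finiteDimensional
  have : FiniteDimensional ℚ T := NumberField.to_finiteDimensional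
  have : FiniteDimensional ℚ L := IntermediateField.finiteDimensional_sup K T
  have hLn : NumberField L := ⟨⟩
  let iK : Algebra K L := (IntermediateField.inclusion (le_sup_left : K ≤ L)).toAlgebra
  let iT : Algebra T L := (IntermediateField.inclusion (le_sup_right : T ≤ L)).toAlgebra
  have hKL : ∀ x : K, ((algebraMap K L x : L) : QBar) = x := fun x => rfl
  have hTL : ∀ x : T, ((algebraMap T L x : L) : QBar) = x := fun x => rfl
  let u : Fin 2 → Tˣ := fun i => Units.mk0 (invCoord ω i) fun h => by
    have : (ω i : QBar)⁻¹ = 0 := congrArg (Subtype.val) h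
    simp at this
  obtain ⟨N, hN, hωN⟩ := isOfFinOrder_iff_pow_eq_one.1 hω
  have hωi : ∀ i, (ω i : QBar) ^ N = 1 := fun i => by
    simpa using congrArg Units.val (congrFun hωN i)
  have huN : ∀ i, u i ^ N = 1 := fun i => by
    apply Units.ext
    apply Subtype.ext
    change ((ω i : QBar)⁻¹) ^ N = 1
    rw [inv_pow, hωi, inv_one]
  have hu : ∀ i, IsOfFinOrder (u i) := fun i =>
    isOfFinOrder_iff_pow_eq_one.2 ⟨N, hN, huN i⟩
  obtain ⟨z, d, i, j, m, n, hd, hz, hai, hbj, hmn⟩ := exists_primitiveRoot_pair (hu 0) (hu 1)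
  change invCoord ω 0 = _ at hai
  change invCoord ω 1 = _ at hbj
  have hd2 : 2 ≤ d := by
    by_contra! hlt
    obtain rfl : d = 1 := by omega
    have hz1 : z = 1 := by simpa using hz
    subst hz1
    apply h1
    have h0 : (ω 0 : QBar)⁻¹ = 1 := by
      have := congrArg (Subtype.val) hai
      simpa [invCoord] using this
    have h1' : (ω 1 : QBar)⁻¹ = 1 := by
      have := congrArg (Subtype.val) hbj
      simpa [invCoord] using this
    ext k
    fin_cases k
    · simpa using h0
    · simpa using h1'
  have hord : orderOf (ω 0) ≤ d := by
    refine Nat.le_of_dvd hd (orderOf_dvd_of_pow_eq_one ?_)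
    have h2 : invCoord ω 0 ^ d = 1 := by rw [hai, pow_right_comm, hz.pow_eq_one, one_pow]
    have h3 : ((ω 0 : QBar)⁻¹) ^ d = 1 := congrArg (Subtype.val) h2
    apply Units.ext
    rw [inv_pow, inv_eq_one] at h3
    simpa using h3
  let zL : L := algebraMap T L z
  have hzL : IsPrimitiveRoot zL d := hz.map_of_injective (algebraMap T L).injective
  have haL : ((zL ^ i : L) : QBar) = (ω 0 : QBar)⁻¹ := congrArg (Subtype.val) hai.symm
  have hbL : ((zL ^ j : L) : QBar) = (ω 1 : QBar)⁻¹ := congrArg (Subtype.val) hbj.symm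
  have hmnL : zL = (zL ^ i) ^ m * (zL ^ j) ^ n := by
    have := congrArg (algebraMap T L) hmn
    simpa only [map_mul, map_pow] using this
  have hht := logHeight_rootsOfUnity hd2 hzL i j m n hmnL
  let w : Fin 3 → L := ![zL ^ j - zL ^ i, 1 - zL ^ j, zL ^ i - 1]
  have hwv : ∀ k, (w k : QBar) = v k := by
    intro k
    rw [hvdef, ← haL, ← hbL]
    fin_cases k <;> rfl
  obtain ⟨k, hk⟩ := Function.ne_iff.1 hv
  have hrk : ∀ k, r k = c * v k := fun k => by rw [← hc]; rfl
  have hcL : c ∈ L := by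
    have e : c = r k / v k := by rw [hrk, mul_div_cancel_right₀ _ hk]
    rw [e, ← hwv]
    exact div_mem ((le_sup_left : K ≤ L) (coords r k).2) (w k).2
  have hcoords0 : coords r ≠ 0 := by
    intro h
    exact hr0 (funext fun k => congrArg Subtype.val (congrFun h k))
  have e1 := logHeight_algebraMap (K := K) (L := L) (coords r) hcoords0
  have e2 : (fun k => algebraMap K L (coords r k)) = (⟨c, hcL⟩ : L) • w := by
    funext k
    apply Subtype.ext
    rw [hKL]
    change r k = c * (w k : QBar)
    rw [hrk, hwv]
  rw [e2, Height.logHeight_smul_eq_logHeight w (fun h => hc0 (congrArg Subtype.val h)), hht] at e1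
  have hKLf : (Module.finrank ℚ K : ℝ) * Module.finrank K L = Module.finrank ℚ L := by
    exact_mod_cast Module.finrank_mul_finrank ℚ K L
  have hK0 : (Module.finrank ℚ K : ℝ) ≠ 0 := by exact_mod_cast (Module.finrank_pos).ne'
  have hKL0 : (Module.finrank K L : ℝ) ≠ 0 := by
    intro h
    rw [h, mul_zero] at hKLf
    exact (Module.finrank_pos (R := ℚ) (M := L)).ne' (by exact_mod_cast hKLf.symm)
  have hheight : interHeight ω =
      embAvg L (fun σ => Real.log (side (σ (zL ^ i)) (σ (zL ^ j)))) -
        embAvg L (fun σ => Real.log ‖1 - σ zL‖) := by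
    rw [hinter]
    change Height.logHeight (coords r) / (Module.finrank ℚ K : ℝ) = _
    rw [div_eq_iff hK0]
    apply mul_left_cancel₀ hKL0
    rw [← e1, ← hKLf]
    ring
  have hrestr := embAvg_restrict (K := T) (L := L)
    (fun σ => Real.log (side (σ (invCoord ω 0)) (σ (invCoord ω 1))))
  have hrestr' : embAvg L (fun σ => Real.log (side (σ (zL ^ i)) (σ (zL ^ j)))) =
      orbitAvg ω (fun x y => Real.log (side x y)) := by
    rw [orbitAvg, ← hrestr, hai, hbj]
    rfl
  have hlog := embAvg_log_norm_one_sub hd2 hzL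
  rw [hrestr'] at hheight
  exact ⟨d, hd2, hord, by linarith, by linarith⟩

/-! ### Integrals against the logarithm of the sine -/

section

open MeasureTheory Real

theorem intervalIntegrable_log_two_mul_sin (a b : ℝ) :
    IntervalIntegrable (fun t => log (2 * sin (π * t))) volume a b := by
  have : MeromorphicOn (fun t : ℝ => 2 * sin (π * t)) (Set.uIcc a b) := fun t _ => by
    have : AnalyticAt ℝ (fun t : ℝ => 2 * sin (π * t)) t := by fun_prop
    exact this.meromorphicAt
  exact this.intervalIntegrable_log

theorem integral_log_two_mul_sin : ∫ t in (0 : ℝ)..(1 / 2), log (2 * sin (π * t)) = 0 := by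
  have h1 : ∫ t in (0 : ℝ)..(1 / 2), log (2 * sin (π * t)) =
      ∫ t in (0 : ℝ)..(1 / 2), (log 2 + log (sin (π * t))) := by
    refine intervalIntegral.integral_congr_ae (Eventually.of_forall fun t ht => ?_)
    rw [Set.uIoc_of_le (by norm_num)] at ht
    refine log_mul two_ne_zero (sin_pos_of_pos_of_lt_pi (mul_pos pi_pos ht.1) ?_).ne'
    nlinarith [pi_pos, ht.2]
  have h2 : IntervalIntegrable (fun t => log (sin (π * t))) volume 0 (1 / 2) := by
    have : MeromorphicOn (fun t : ℝ => sin (π * t)) (Set.uIcc 0 (1 / 2)) := fun t _ => by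
      have : AnalyticAt ℝ (fun t : ℝ => sin (π * t)) t := by fun_prop
      exact this.meromorphicAt
    exact this.intervalIntegrable_log
  rw [h1, intervalIntegral.integral_add intervalIntegrable_const h2,
    intervalIntegral.integral_comp_mul_left (fun x => log (sin x)) pi_ne_zero, mul_zero,
    mul_one_div, integral_log_sin_zero_pi_div_two, intervalIntegral.integral_const]
  simp only [smul_eq_mul]
  field_simp
  ring

/-- The quotient of `sin (2 π k t)` by `sin (π t)`. -/
noncomputable def sinQuot (k : ℕ) (t : ℝ) : ℝ :=
  ∑ j ∈ Finset.range k, 2 * cos ((2 * j + 1) * π * t)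

theorem sinQuot_mul_sin (k : ℕ) (t : ℝ) : sinQuot k t * sin (π * t) = sin (2 * π * k * t) := by
  induction k with
  | zero => simp [sinQuot]
  | succ k ih =>
    rw [sinQuot, Finset.sum_range_succ, ← sinQuot, add_mul, ih]
    have h1 := sin_sub_sin (2 * π * (k + 1) * t) (2 * π * k * t)
    push_cast
    rw [show (2 * π * (k + 1) * t - 2 * π * k * t) / 2 = π * t by ring,
      show (2 * π * (k + 1) * t + 2 * π * k * t) / 2 = (2 * k + 1) * π * t by ring] at h1
    linarith

theorem continuous_sinQuot (k : ℕ) : Continuous (sinQuot k) := by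
  unfold sinQuot; fun_prop

theorem integral_cos_two_mul (j : ℕ) (hj : j ≠ 0) :
    ∫ t in (0 : ℝ)..(1 / 2), cos (2 * π * j * t) = 0 := by
  have hj' : (j : ℝ) ≠ 0 := by exact_mod_cast hj
  have : 2 * π * j ≠ 0 := by have := pi_ne_zero; positivity
  rw [intervalIntegral.integral_comp_mul_left (fun x => cos x) this, integral_cos,
    show 2 * π * j * (1 / 2) = j * π by ring, sin_nat_mul_pi]
  simp

theorem integral_sinQuot_mul_cos (k : ℕ) (hk : k ≠ 0) :
    ∫ t in (0 : ℝ)..(1 / 2), sinQuot k t * cos (π * t) = 1 / 2 := by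
  have h1 : ∀ t, sinQuot k t * cos (π * t) = ∑ j ∈ Finset.range k,
      (cos (2 * π * (j + 1 : ℕ) * t) + cos (2 * π * (j : ℕ) * t)) := by
    intro t
    rw [sinQuot, Finset.sum_mul]
    refine Finset.sum_congr rfl fun j _ => ?_
    rw [cos_add_cos]
    push_cast
    rw [show (2 * π * (j + 1) * t + 2 * π * j * t) / 2 = (2 * j + 1) * π * t by ring,
      show (2 * π * (j + 1) * t - 2 * π * j * t) / 2 = π * t by ring]
  have hint : ∀ j : ℕ, IntervalIntegrable (fun t => cos (2 * π * j * t)) volume 0 (1 / 2) :=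
    fun j => Continuous.intervalIntegrable (by fun_prop) _ _
  simp_rw [h1]
  rw [intervalIntegral.integral_finsetSum fun j _ => (hint _).add (hint _)]
  obtain ⟨k, rfl⟩ := Nat.exists_eq_succ_of_ne_zero hk
  rw [Finset.sum_range_succ', Finset.sum_eq_zero, zero_add,
    intervalIntegral.integral_add (hint _) (hint _), integral_cos_two_mul _ (by simp)]
  · simp
  · intro j _
    rw [intervalIntegral.integral_add (hint _) (hint _), integral_cos_two_mul _ (by simp),
      integral_cos_two_mul _ (by simp), add_zero]

/-- Integration by parts, using that `sin (2 π k t) / sin (π t)` is a trigonometric polynomial. -/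
theorem integral_cos_mul_log_two_mul_sin (k : ℕ) (hk : k ≠ 0) :
    ∫ t in (0 : ℝ)..(1 / 2), cos (2 * π * k * t) * log (2 * sin (π * t)) = -1 / (4 * k) := by
  have hk' : (k : ℝ) ≠ 0 := by exact_mod_cast hk
  have hpi := pi_ne_zero
  have hI1 : IntervalIntegrable (fun t => cos (2 * π * k * t) * log (2 * sin (π * t)))
      volume 0 (1 / 2) :=
    (intervalIntegrable_log_two_mul_sin 0 (1 / 2)).continuousOn_mul (by fun_prop)
  have hI2 : IntervalIntegrable (fun t => (1 / (2 * k)) * (sinQuot k t * cos (π * t)))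
      volume 0 (1 / 2) := by
    apply Continuous.intervalIntegrable
    have := continuous_sinQuot k
    fun_prop
  -- `G` is a primitive of the integrand plus an elementary term, and it is continuous at `0`
  -- because `x * log x` is.
  let G : ℝ → ℝ := fun t =>
    sinQuot k t * ((2 * sin (π * t)) * log (2 * sin (π * t))) / (4 * π * k)
  have hGc : Continuous G := by
    have h1 := continuous_sinQuot k
    have h2 : Continuous fun t => (2 * sin (π * t)) * log (2 * sin (π * t)) :=
      continuous_mul_log.comp (by fun_prop : Continuous fun t => 2 * sin (π * t))
    exact (h1.mul h2).div_const _
  have hG : ∀ t, G t = sin (2 * π * k * t) * log (2 * sin (π * t)) / (2 * π * k) := by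
    intro t
    rw [← sinQuot_mul_sin]
    simp only [G]
    field_simp
    ring
  have hderiv : ∀ t ∈ Set.Ioo (0 : ℝ) (1 / 2), HasDerivAt G
      (cos (2 * π * k * t) * log (2 * sin (π * t)) +
        (1 / (2 * k)) * (sinQuot k t * cos (π * t))) t := by
    intro t ht
    have hs : 0 < sin (π * t) := by
      refine sin_pos_of_pos_of_lt_pi (mul_pos pi_pos ht.1) ?_
      nlinarith [pi_pos, ht.2]
    rw [show G = fun t => sin (2 * π * k * t) * log (2 * sin (π * t)) / (2 * π * k) from funext hG]
    have d1 : HasDerivAt (fun t => sin (2 * π * k * t)) (cos (2 * π * k * t) * (2 * π * k)) t := by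
      simpa using ((hasDerivAt_id t).const_mul (2 * π * k)).sin
    have d2 : HasDerivAt (fun t => 2 * sin (π * t)) (2 * (cos (π * t) * π)) t := by
      simpa using (((hasDerivAt_id t).const_mul π).sin).const_mul 2
    have d3 := (d1.mul (d2.log (by positivity))).div_const (2 * π * k)
    refine d3.congr_deriv ?_
    rw [← sinQuot_mul_sin]
    field_simp
  have key := intervalIntegral.integral_eq_sub_of_hasDerivAt_of_le (by norm_num) hGc.continuousOn
    hderiv (hI1.add hI2)
  rw [intervalIntegral.integral_add hI1 hI2, intervalIntegral.integral_const_mul,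
    integral_sinQuot_mul_cos k hk] at key
  have hG1 : G (1 / 2) = 0 := by
    rw [hG, show 2 * π * k * (1 / 2) = k * π by ring, sin_nat_mul_pi]; simp
  have hG0 : G 0 = 0 := by rw [hG]; simp
  rw [hG1, hG0] at key
  have : ∫ t in (0 : ℝ)..(1 / 2), cos (2 * π * k * t) * log (2 * sin (π * t)) =
    -(1 / (2 * k) * (1 / 2)) := by linarith
  rw [this]
  field_simp
  norm_num

/-- Up to a constant factor, the first factor of the integrand is the periodic second Bernoulli
function at `n * t`. -/
theorem integral_tsum_cos_mul_log_two_mul_sin (n : ℕ) (hn : n ≠ 0) :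
    ∫ t in (0 : ℝ)..(1 / 2), (∑' k : ℕ, 1 / (k : ℝ) ^ 2 * cos (2 * π * k * (n * t))) *
      log (2 * sin (π * t)) = -(∑' k : ℕ, 1 / (k : ℝ) ^ 3) / (4 * n) := by
  have hn' : (n : ℝ) ≠ 0 := by exact_mod_cast hn
  have hL := intervalIntegrable_log_two_mul_sin 0 (1 / 2)
  have hs2 : Summable fun k : ℕ => 1 / (k : ℝ) ^ 2 := by simp
  have hbd : ∀ (k : ℕ) (t : ℝ), ‖1 / (k : ℝ) ^ 2 * cos (2 * π * k * (n * t))‖ ≤ 1 / (k : ℝ) ^ 2 := by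
    intro k t
    rw [norm_mul, Real.norm_of_nonneg (by positivity)]
    exact mul_le_of_le_one_right (by positivity) (abs_cos_le_one _)
  have key := intervalIntegral.hasSum_integral_of_dominated_convergence
    (F := fun (k : ℕ) t => 1 / (k : ℝ) ^ 2 * cos (2 * π * k * (n * t)) * log (2 * sin (π * t)))
    (f := fun t => (∑' k : ℕ, 1 / (k : ℝ) ^ 2 * cos (2 * π * k * (n * t))) *
      log (2 * sin (π * t))) (a := 0) (b := 1 / 2) (μ := volume)
    (fun k t => 1 / (k : ℝ) ^ 2 * |log (2 * sin (π * t))|)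
    (fun k => by
      have h : IntervalIntegrable (fun t => 1 / (k : ℝ) ^ 2 * cos (2 * π * k * (n * t)) *
        log (2 * sin (π * t))) volume 0 (1 / 2) := hL.continuousOn_mul (by fun_prop)
      exact (intervalIntegrable_iff.1 h).aestronglyMeasurable)
    (fun k => Eventually.of_forall fun t _ => by
      rw [norm_mul]
      exact mul_le_mul_of_nonneg_right (hbd k t) (abs_nonneg _))
    (Eventually.of_forall fun t _ => hs2.mul_right _)
    (by
      simp_rw [tsum_mul_right]
      exact hL.abs.const_mul _)
    (Eventually.of_forall fun t _ => (hs2.of_norm_bounded (hbd · t)).hasSum.mul_right _)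
  rw [← key.tsum_eq, ← tsum_neg, ← tsum_div_const]
  refine tsum_congr fun k => ?_
  rcases eq_or_ne k 0 with rfl | hk
  · simp
  have hk' : (k : ℝ) ≠ 0 := by exact_mod_cast hk
  have := integral_cos_mul_log_two_mul_sin (n * k) (by positivity)
  simp_rw [mul_assoc (1 / (k : ℝ) ^ 2)]
  rw [intervalIntegral.integral_const_mul]
  have e : ∀ t : ℝ, 2 * π * k * (n * t) = 2 * π * ((n * k : ℕ) : ℝ) * t := fun t => by
    push_cast; ring
  simp_rw [e]
  rw [this]
  push_cast
  field_simp

theorem tsum_cos_eq {x : ℝ} (hx : x ∈ Set.Icc (0 : ℝ) 1) :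
    ∑' k : ℕ, 1 / (k : ℝ) ^ 2 * cos (2 * π * k * x) = π ^ 2 * (x ^ 2 - x + 1 / 6) := by
  have h := (hasSum_one_div_nat_pow_mul_cos (k := 1) one_ne_zero hx).tsum_eq
  rw [mul_one] at h
  rw [h]
  have := bernoulliFun_two x
  rw [bernoulliFun] at this
  rw [this]
  rw [show ((Nat.factorial 2 : ℕ) : ℝ) = 2 by norm_num [Nat.factorial]]
  ring

/-- The left-hand side extends to an even, `1`-periodic, piecewise linear function of `t`, whose slope
jumps at multiples of `1/2` and `1/3` only; hence it is a combination of periodic second Bernoulli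
functions. -/
theorem add_max_eq_tsum_cos {t : ℝ} (ht : t ∈ Set.Icc (0 : ℝ) (1 / 2)) :
    t + max 0 (3 * t - 1) = 1 / 3 - 1 / (2 * π ^ 2) *
      (7 * ∑' k : ℕ, 1 / (k : ℝ) ^ 2 * cos (2 * π * k * ((1 : ℕ) * t)) -
       4 * ∑' k : ℕ, 1 / (k : ℝ) ^ 2 * cos (2 * π * k * ((2 : ℕ) * t)) +
       ∑' k : ℕ, 1 / (k : ℝ) ^ 2 * cos (2 * π * k * ((3 : ℕ) * t))) := by
  obtain ⟨h0, h1⟩ := ht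
  have hpi := pi_ne_zero
  push_cast
  rw [tsum_cos_eq (x := 1 * t) ⟨by linarith, by linarith⟩,
    tsum_cos_eq (x := 2 * t) ⟨by linarith, by linarith⟩]
  rcases le_total (3 * t) 1 with h | h
  · rw [tsum_cos_eq ⟨by linarith, h⟩, max_eq_left (by linarith)]
    field_simp
    ring
  · have e : ∀ k : ℕ, cos (2 * π * k * (3 * t)) = cos (2 * π * k * (3 * t - 1)) := fun k => by
      rw [show 2 * π * k * (3 * t) = 2 * π * k * (3 * t - 1) + k * (2 * π) by ring,
        cos_add_nat_mul_two_pi]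
    simp_rw [e]
    rw [tsum_cos_eq ⟨by linarith, by linarith⟩, max_eq_right (by linarith)]
    field_simp
    ring

theorem integral_add_max_mul_log :
    ∫ t in (0 : ℝ)..(1 / 2), (t + max 0 (3 * t - 1)) * log (2 * sin (π * t)) =
      2 * (∑' k : ℕ, 1 / (k : ℝ) ^ 3) / (3 * π ^ 2) := by
  have hL := intervalIntegrable_log_two_mul_sin 0 (1 / 2)
  have hpi := pi_ne_zero
  have hcont : ∀ n : ℕ, Continuous fun t : ℝ =>
      ∑' k : ℕ, 1 / (k : ℝ) ^ 2 * cos (2 * π * k * (n * t)) := fun n => by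
    have hs2 : Summable fun k : ℕ => 1 / (k : ℝ) ^ 2 := by simp
    refine continuous_tsum (fun k => by fun_prop) hs2 fun k t => ?_
    rw [norm_mul, Real.norm_of_nonneg (by positivity)]
    exact mul_le_of_le_one_right (by positivity) (abs_cos_le_one _)
  have hI : ∀ n : ℕ, IntervalIntegrable (fun t => (∑' k : ℕ, 1 / (k : ℝ) ^ 2 *
      cos (2 * π * k * (n * t))) * log (2 * sin (π * t))) volume 0 (1 / 2) := fun n =>
    hL.continuousOn_mul (hcont n).continuousOn
  have hcongr : ∫ t in (0 : ℝ)..(1 / 2), (t + max 0 (3 * t - 1)) * log (2 * sin (π * t)) =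
      ∫ t in (0 : ℝ)..(1 / 2), (1 / 3 * log (2 * sin (π * t)) - 1 / (2 * π ^ 2) *
      (7 * ((∑' k : ℕ, 1 / (k : ℝ) ^ 2 * cos (2 * π * k * ((1 : ℕ) * t))) *
          log (2 * sin (π * t))) -
       4 * ((∑' k : ℕ, 1 / (k : ℝ) ^ 2 * cos (2 * π * k * ((2 : ℕ) * t))) *
          log (2 * sin (π * t))) +
       (∑' k : ℕ, 1 / (k : ℝ) ^ 2 * cos (2 * π * k * ((3 : ℕ) * t))) *
          log (2 * sin (π * t)))) := by
    refine intervalIntegral.integral_congr fun t ht => ?_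
    rw [Set.uIcc_of_le (by norm_num)] at ht
    rw [add_max_eq_tsum_cos ht]
    ring
  rw [hcongr, intervalIntegral.integral_sub (hL.const_mul _)
      (((((hI 1).const_mul _).sub ((hI 2).const_mul _)).add (hI 3)).const_mul _),
    intervalIntegral.integral_const_mul, intervalIntegral.integral_const_mul,
    intervalIntegral.integral_add (((hI 1).const_mul _).sub ((hI 2).const_mul _)) (hI 3),
    intervalIntegral.integral_sub ((hI 1).const_mul _) ((hI 2).const_mul _),
    intervalIntegral.integral_const_mul, intervalIntegral.integral_const_mul,
    integral_log_two_mul_sin, integral_tsum_cos_mul_log_two_mul_sin 1 one_ne_zero,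
    integral_tsum_cos_mul_log_two_mul_sin 2 two_ne_zero,
    integral_tsum_cos_mul_log_two_mul_sin 3 three_ne_zero]
  push_cast
  field_simp
  ring

end

/-! ### Chords and lenses on the circle -/

section

open MeasureTheory Real

theorem norm_coe_of_abs_le {x : ℝ} (hx : |x| ≤ 1 / 2) : ‖(x : UnitAddCircle)‖ = |x| := by
  rw [AddCircle.norm_coe_eq_abs_iff 1 one_ne_zero]; simpa using hx

theorem norm_coe_of_half_le {x : ℝ} (h1 : 1 / 2 ≤ x) (h2 : x ≤ 1) :
    ‖(x : UnitAddCircle)‖ = 1 - x := by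
  have : (x : UnitAddCircle) = ((x - 1 : ℝ) : UnitAddCircle) := by
    rw [AddCircle.coe_sub, AddCircle.coe_period, sub_zero]
  rw [this, norm_coe_of_abs_le (by rw [abs_le]; constructor <;> linarith),
    abs_of_nonpos (by linarith), neg_sub]

theorem norm_le_half (u : UnitAddCircle) : ‖u‖ ≤ 1 / 2 := by
  have := AddCircle.norm_le_half_period 1 one_ne_zero (x := u)
  simpa using this

theorem exists_eq_coe (u : UnitAddCircle) : ∃ x : ℝ, |x| ≤ 1 / 2 ∧ (x : UnitAddCircle) = u := by
  obtain ⟨x, hx, rfl⟩ := AddCircle.eq_coe_Ico (p := (1 : ℝ)) u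
  rcases le_total x (1 / 2) with h | h
  · exact ⟨x, by rw [abs_of_nonneg hx.1]; exact h, rfl⟩
  · refine ⟨x - 1, by rw [abs_le]; constructor <;> linarith [hx.2], ?_⟩
    rw [AddCircle.coe_sub, AddCircle.coe_period, sub_zero]

theorem norm_toCircle_sub_one (u : UnitAddCircle) :
    ‖(AddCircle.toCircle u : ℂ) - 1‖ = 2 * sin (π * ‖u‖) := by
  obtain ⟨x, hx, rfl⟩ := exists_eq_coe u
  rw [norm_coe_of_abs_le hx, AddCircle.toCircle_apply_mk, Circle.coe_exp, mul_comm _ Complex.I,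
    Complex.norm_exp_I_mul_ofReal_sub_one, norm_mul, Real.norm_eq_abs, Real.norm_eq_abs,
    abs_of_pos two_pos, show 2 * π / 1 * x / 2 = π * x by ring]
  congr 1
  have hpi := pi_pos
  rcases abs_cases x with ⟨h, h'⟩ | ⟨h, h'⟩
  · rw [h, abs_of_nonneg]
    rw [h] at hx
    exact sin_nonneg_of_nonneg_of_le_pi (by positivity) (by nlinarith)
  · rw [h, mul_neg, sin_neg, abs_of_nonpos]
    rw [h] at hx
    exact sin_nonpos_of_nonpos_of_neg_pi_le (by nlinarith) (by nlinarith)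

theorem norm_toCircle_sub (u v : UnitAddCircle) :
    ‖(AddCircle.toCircle u : ℂ) - AddCircle.toCircle v‖ = 2 * sin (π * ‖u - v‖) := by
  rw [← norm_toCircle_sub_one]
  have h : (AddCircle.toCircle u : ℂ) =
      AddCircle.toCircle (u - v) * AddCircle.toCircle v := by
    rw [← Circle.coe_mul, ← AddCircle.toCircle_add, sub_add_cancel]
  rw [h, ← sub_one_mul, norm_mul, Circle.norm_coe, mul_one]

theorem monotoneOn_two_mul_sin : MonotoneOn (fun r => 2 * sin (π * r)) (Set.Icc 0 (1 / 2)) := by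
  intro a ha b hb hab
  have hpi := pi_pos
  have : sin (π * a) ≤ sin (π * b) :=
    sin_le_sin_of_le_of_le_pi_div_two (by nlinarith [ha.1]) (by nlinarith [hb.2]) (by gcongr)
  simpa using this

/-- The longest side of the triangle with vertices `1`, `e(u)`, `e(v)` on the unit circle. -/
theorem side_toCircle (u v : UnitAddCircle) :
    side (AddCircle.toCircle u) (AddCircle.toCircle v) =
      2 * sin (π * max ‖u‖ (max ‖v‖ ‖u - v‖)) := by
  have h0 : ∀ w : UnitAddCircle, ‖w‖ ∈ Set.Icc (0 : ℝ) (1 / 2) := fun w =>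
    ⟨norm_nonneg _, norm_le_half w⟩
  have hm : max ‖v‖ ‖u - v‖ ∈ Set.Icc (0 : ℝ) (1 / 2) :=
    ⟨le_max_of_le_left (norm_nonneg _), max_le (norm_le_half _) (norm_le_half _)⟩
  rw [monotoneOn_two_mul_sin.map_max (h0 u) hm, monotoneOn_two_mul_sin.map_max (h0 v) (h0 _),
    ← norm_toCircle_sub, ← norm_toCircle_sub_one, ← norm_toCircle_sub_one, side,
    norm_sub_rev 1, norm_sub_rev 1]

theorem integral_comp_norm (f : ℝ → ℝ) (hf : IntervalIntegrable f volume 0 (1 / 2)) :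
    ∫ u : UnitAddCircle, f ‖u‖ = 2 * ∫ t in (0 : ℝ)..(1 / 2), f t := by
  rw [← UnitAddCircle.intervalIntegral_preimage (-(1 / 2))]
  have h1 : Set.EqOn (fun a : ℝ => f ‖(a : UnitAddCircle)‖) (fun a => f a) (Set.uIcc 0 (1 / 2)) := by
    intro a ha
    rw [Set.uIcc_of_le (by norm_num)] at ha
    beta_reduce
    rw [norm_coe_of_abs_le (by rw [abs_of_nonneg ha.1]; exact ha.2), abs_of_nonneg ha.1]
  have h2 : Set.EqOn (fun a : ℝ => f ‖(a : UnitAddCircle)‖) (fun a => f (-a))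
      (Set.uIcc (-(1 / 2)) 0) := by
    intro a ha
    rw [Set.uIcc_of_le (by norm_num)] at ha
    beta_reduce
    rw [norm_coe_of_abs_le (by rw [abs_of_nonpos ha.2]; linarith [ha.1]), abs_of_nonpos ha.2]
  have hf' : IntervalIntegrable (fun a => f (-a)) volume (-(1 / 2)) 0 := by
    have := (IntervalIntegrable.iff_comp_neg).1 hf
    simpa using this.symm
  rw [show -(1 / 2 : ℝ) + 1 = 1 / 2 by norm_num, ← intervalIntegral.integral_add_adjacent_intervals
    (b := 0) (hf'.congr (h2.symm.mono Set.uIoc_subset_uIcc))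
    (hf.congr (h1.symm.mono Set.uIoc_subset_uIcc)),
    intervalIntegral.integral_congr h1, intervalIntegral.integral_congr h2,
    intervalIntegral.integral_comp_neg f]
  simp
  ring

theorem integrable_comp_norm {f : ℝ → ℝ} (hm : Measurable f)
    (hf : IntervalIntegrable f volume 0 (1 / 2)) :
    Integrable fun u : UnitAddCircle => f ‖u‖ := by
  have hmp := UnitAddCircle.measurePreserving_mk (-(1 / 2))
  have hmeas : Measurable fun u : UnitAddCircle => f ‖u‖ := hm.comp measurable_norm
  rw [← hmp.integrable_comp hmeas.aestronglyMeasurable, show -(1 / 2 : ℝ) + 1 = 1 / 2 by norm_num]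
  have hf' : IntervalIntegrable (fun a => f (-a)) volume (-(1 / 2)) 0 := by
    have := (IntervalIntegrable.iff_comp_neg).1 hf
    simpa using this.symm
  have h1 : IntervalIntegrable (fun a => f |a|) volume 0 (1 / 2) := by
    refine hf.congr fun a ha => ?_
    rw [Set.uIoc_of_le (by norm_num)] at ha
    simp only [abs_of_pos ha.1]
  have h2 : IntervalIntegrable (fun a => f |a|) volume (-(1 / 2)) 0 := by
    refine hf'.congr fun a ha => ?_
    rw [Set.uIoc_of_le (by norm_num)] at ha
    simp only [abs_of_nonpos ha.2]
  have h3 := (intervalIntegrable_iff_integrableOn_Ioc_of_le (by norm_num)).1 (h2.trans h1)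
  refine h3.congr_fun (fun a ha => ?_) measurableSet_Ioc
  have : |a| ≤ 1 / 2 := by rw [abs_le]; exact ⟨ha.1.le, ha.2⟩
  simp only [Function.comp, norm_coe_of_abs_le this]

theorem volume_singleton_circle (u : UnitAddCircle) : volume {u} = 0 := by
  have h := AddCircle.volume_closedBall (T := 1) (x := u) 0
  rw [Metric.closedBall_zero] at h
  simpa using h

theorem measurableSet_lens (u : UnitAddCircle) (r : ℝ) :
    MeasurableSet {v : UnitAddCircle | ‖v‖ ≤ r ∧ ‖u - v‖ ≤ r} := by
  have : {v : UnitAddCircle | ‖v‖ ≤ r ∧ ‖u - v‖ ≤ r} =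
      Metric.closedBall 0 r ∩ Metric.closedBall u r := by
    ext v
    simp [dist_eq_norm, norm_sub_rev u v]
  rw [this]
  exact measurableSet_closedBall.inter measurableSet_closedBall

theorem measurable_log_two_mul_sin : Measurable fun r => log (2 * sin (π * r)) := by
  fun_prop

/-- For `‖u‖ ≤ 1/3` the points at distance at most `‖u‖` from both `0` and `u` form the arc from `0`
to `u`; for larger `‖u‖` there is a second arc, opposite to the first, of length `3 ‖u‖ - 1`. -/
theorem volume_lens (u : UnitAddCircle) :
    volume.real {v : UnitAddCircle | ‖v‖ ≤ ‖u‖ ∧ ‖u - v‖ ≤ ‖u‖} = ‖u‖ + max 0 (3 * ‖u‖ - 1) := by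
  -- The reflection `v ↦ -v` allows `u` to be represented in `[0, 1/2]`.
  wlog hu : ∃ t : ℝ, 0 ≤ t ∧ t ≤ 1 / 2 ∧ (t : UnitAddCircle) = u generalizing u
  · obtain ⟨x, hx, rfl⟩ := exists_eq_coe u
    have hx0 : x < 0 := by
      by_contra! h
      exact hu ⟨x, h, by rwa [abs_of_nonneg h] at hx, rfl⟩
    have key := this (-(x : UnitAddCircle)) ⟨-x, by linarith, by rwa [abs_of_neg hx0] at hx, by simp⟩
    rw [norm_neg] at key
    rw [← key]
    have hmp := Measure.measurePreserving_neg (volume : Measure UnitAddCircle)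
    rw [← hmp.measureReal_preimage (measurableSet_lens _ _).nullMeasurableSet]
    congr 1
    ext v
    simp only [Set.mem_ofPred_eq, Set.mem_preimage, norm_neg]
    rw [show (x : UnitAddCircle) - -v = -(-x - v) by abel, norm_neg]
  obtain ⟨t, ht0, ht1, rfl⟩ := hu
  have hnt : ‖(t : UnitAddCircle)‖ = t := by
    rw [norm_coe_of_abs_le (by rwa [abs_of_nonneg ht0]), abs_of_nonneg ht0]
  rw [measureReal_def, AddCircle.add_projection_respects_measure 1 0 (measurableSet_lens _ _),
    hnt, zero_add]
  have hae : ((QuotientAddGroup.mk : ℝ → UnitAddCircle) ⁻¹' {v : UnitAddCircle | ‖v‖ ≤ t ∧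
      ‖(t : UnitAddCircle) - v‖ ≤ t} ∩ Set.Ioc 0 1 : Set ℝ) =ᵐ[volume]
      (Set.Ioc 0 t ∪ Set.Ioc (1 - t) (2 * t) : Set ℝ) := by
    have h1 : ∀ᵐ v : ℝ, v ≠ 1 := by simp [ae_iff]
    have h2 : ∀ᵐ v : ℝ, v ≠ 1 - t := by simp [ae_iff]
    filter_upwards [h1, h2] with v hv1 hv2
    apply propext
    change ((‖(v : UnitAddCircle)‖ ≤ t ∧ ‖((t : UnitAddCircle) - (v : UnitAddCircle))‖ ≤ t) ∧
      (0 < v ∧ v ≤ 1)) ↔ ((0 < v ∧ v ≤ t) ∨ (1 - t < v ∧ v ≤ 2 * t))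
    have hv1' : v ≤ 1 → v < 1 := fun h => lt_of_le_of_ne h hv1
    have hv2' : 1 - t ≤ v → 1 - t < v := fun h => lt_of_le_of_ne h hv2.symm
    have hn1 : 0 < v → v ≤ 1 → (‖(v : UnitAddCircle)‖ ≤ t ↔ v ≤ t ∨ 1 - t < v) := by
      intro h0 h1
      rcases le_total v (1 / 2) with h | h
      · rw [norm_coe_of_abs_le (by rwa [abs_of_pos h0]), abs_of_pos h0]
        constructor
        · exact fun h => Or.inl h
        · rintro (h | h)
          · exact h
          · linarith
      · rw [norm_coe_of_half_le h h1]
        constructor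
        · exact fun h => Or.inr (hv2' (by linarith))
        · rintro (h | h) <;> linarith
    have hn2 : 0 < v → v ≤ 1 → (‖((t : UnitAddCircle) - (v : UnitAddCircle))‖ ≤ t ↔ v ≤ 2 * t) := by
      intro h0 h1
      have h1' := hv1' h1
      rw [norm_sub_rev, ← AddCircle.coe_sub]
      rcases le_total (v - t) (1 / 2) with h | h
      · rw [norm_coe_of_abs_le (by rw [abs_le]; constructor <;> linarith), abs_le]
        constructor
        · intro h; linarith [h.2]
        · intro h; constructor <;> linarith
      · rw [norm_coe_of_half_le h (by linarith)]
        constructor <;> intro h <;> linarith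
    constructor
    · rintro ⟨⟨ha, hb⟩, h0, h1⟩
      rw [hn1 h0 h1] at ha
      rw [hn2 h0 h1] at hb
      rcases ha with ha | ha
      · exact Or.inl ⟨h0, ha⟩
      · exact Or.inr ⟨ha, hb⟩
    · rintro (⟨h0, h⟩ | ⟨h, h'⟩)
      · have h1 : v ≤ 1 := by linarith
        exact ⟨⟨(hn1 h0 h1).2 (Or.inl h), (hn2 h0 h1).2 (by linarith)⟩, h0, h1⟩
      · have h0 : 0 < v := by linarith
        have h1 : v ≤ 1 := by linarith
        exact ⟨⟨(hn1 h0 h1).2 (Or.inr h), (hn2 h0 h1).2 h'⟩, h0, h1⟩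
  rw [measure_congr hae, measure_union _ measurableSet_Ioc, Real.volume_Ioc, Real.volume_Ioc,
    ENNReal.toReal_add (by simp) (by simp), ENNReal.toReal_ofReal (by linarith),
    ENNReal.toReal_ofReal']
  · rw [max_comm, sub_zero, show 2 * t - (1 - t) = 3 * t - 1 by ring]
  · rw [Set.disjoint_left]
    rintro v ⟨_, h⟩ ⟨h', _⟩
    linarith

end

/-! ### The mean of the logarithm of the longest side -/

section

open MeasureTheory Real

instance : NullSingletonClass (volume : Measure UnitAddCircle) := ⟨volume_singleton_circle⟩

/-- The logarithm of the chord of the unit circle spanned by an arc of length `2 π r`. -/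
noncomputable def logChord (r : ℝ) : ℝ := log (2 * sin (π * r))

theorem measurable_logChord : Measurable logChord := measurable_log_two_mul_sin

theorem integrable_logChord_norm : Integrable fun u : UnitAddCircle => logChord ‖u‖ :=
  integrable_comp_norm measurable_logChord (intervalIntegrable_log_two_mul_sin _ _)

theorem integral_logChord_norm : ∫ u : UnitAddCircle, logChord ‖u‖ = 0 := by
  rw [integral_comp_norm logChord (intervalIntegrable_log_two_mul_sin _ _)]
  unfold logChord
  rw [integral_log_two_mul_sin, mul_zero]

open Classical in
/-- `logChord ‖u‖` on the set of `(u, v)` such that the side of the triangle `1`, `e(u)`, `e(v)`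
joining `1` and `e(u)` is the longest, and zero elsewhere. -/
noncomputable def firstSide (p : UnitAddCircle × UnitAddCircle) : ℝ :=
  if ‖p.2‖ ≤ ‖p.1‖ ∧ ‖p.1 - p.2‖ ≤ ‖p.1‖ then logChord ‖p.1‖ else 0

theorem measurableSet_firstSide :
    MeasurableSet {p : UnitAddCircle × UnitAddCircle | ‖p.2‖ ≤ ‖p.1‖ ∧ ‖p.1 - p.2‖ ≤ ‖p.1‖} :=
  MeasurableSet.inter (s₁ := {p : UnitAddCircle × UnitAddCircle | ‖p.2‖ ≤ ‖p.1‖})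
    (s₂ := {p : UnitAddCircle × UnitAddCircle | ‖p.1 - p.2‖ ≤ ‖p.1‖})
    (measurableSet_le (by fun_prop) (by fun_prop)) (measurableSet_le (by fun_prop) (by fun_prop))

theorem firstSide_eq_indicator : firstSide =
    {p : UnitAddCircle × UnitAddCircle | ‖p.2‖ ≤ ‖p.1‖ ∧ ‖p.1 - p.2‖ ≤ ‖p.1‖}.indicator
      fun p => logChord ‖p.1‖ := by
  classical
  funext p
  rw [Set.indicator_apply, firstSide]
  simp only [Set.mem_ofPred_eq]

theorem measurable_firstSide : Measurable firstSide := by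
  rw [firstSide_eq_indicator]
  exact (measurable_logChord.comp (by fun_prop)).indicator measurableSet_firstSide

theorem integrable_firstSide : Integrable firstSide := by
  rw [firstSide_eq_indicator]
  exact (integrable_logChord_norm.comp_fst volume).indicator measurableSet_firstSide

/-- Integrating over the second variable first leaves the length of a lens as a weight. -/
theorem integral_firstSide :
    ∫ p, firstSide p = 4 * (∑' k : ℕ, 1 / (k : ℝ) ^ 3) / (3 * π ^ 2) := by
  have h1 : ∀ u : UnitAddCircle, ∫ v : UnitAddCircle, firstSide (u, v) =
      (‖u‖ + max 0 (3 * ‖u‖ - 1)) * logChord ‖u‖ := by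
    intro u
    classical
    have : (fun v : UnitAddCircle => firstSide (u, v)) =
        {v : UnitAddCircle | ‖v‖ ≤ ‖u‖ ∧ ‖u - v‖ ≤ ‖u‖}.indicator fun _ => logChord ‖u‖ := by
      funext v
      rw [Set.indicator_apply, firstSide]
      simp only [Set.mem_ofPred_eq]
    rw [this, integral_indicator (measurableSet_lens _ _), setIntegral_const, volume_lens,
      smul_eq_mul]
  have hI := integrable_firstSide
  rw [Measure.volume_eq_prod] at hI ⊢
  rw [integral_prod _ hI]
  simp_rw [h1]
  rw [integral_comp_norm (fun r => (r + max 0 (3 * r - 1)) * logChord r)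
    ((intervalIntegrable_log_two_mul_sin _ _).continuousOn_mul (by fun_prop))]
  unfold logChord
  rw [integral_add_max_mul_log]
  ring

/-- Two of the sides have different lengths almost everywhere: for each value of the first variable,
at most two values of the second one are excluded. -/
theorem ae_norm_ne {f : UnitAddCircle → UnitAddCircle → UnitAddCircle}
    (hf : Measurable fun p : UnitAddCircle × UnitAddCircle => f p.1 p.2)
    (hinj : ∀ u, Function.Injective (f u)) (g : UnitAddCircle → UnitAddCircle) (hg : Measurable g) :
    ∀ᵐ p : UnitAddCircle × UnitAddCircle, ‖f p.1 p.2‖ ≠ ‖g p.1‖ := by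
  have hsph : ∀ r : ℝ, {w : UnitAddCircle | ‖w‖ = r}.Finite := by
    intro r
    refine (Set.toFinite {(r : UnitAddCircle), ((-r : ℝ) : UnitAddCircle)}).subset ?_
    intro w hw
    obtain ⟨x, hx, rfl⟩ := exists_eq_coe w
    change ‖(x : UnitAddCircle)‖ = r at hw
    rw [norm_coe_of_abs_le hx] at hw
    rcases (abs_eq (hw ▸ abs_nonneg x)).1 hw with h | h
    · exact Or.inl (by rw [h])
    · exact Or.inr (by rw [h]; rfl)
  have hmeas : MeasurableSet {p : UnitAddCircle × UnitAddCircle | ‖f p.1 p.2‖ = ‖g p.1‖} :=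
    measurableSet_eq_fun (by fun_prop) (by fun_prop)
  rw [ae_iff]
  simp only [ne_eq, not_not]
  rw [Measure.volume_eq_prod, Measure.measure_prod_null hmeas]
  refine Eventually.of_forall fun u => ?_
  exact ((hsph ‖g u‖).preimage (hinj u).injOn).measure_zero _

/-- The three terms are the contributions of the three sides of the triangle; the last two arise from
the first one by measure-preserving automorphisms of the torus. -/
theorem logChord_max_eq :
    (fun p : UnitAddCircle × UnitAddCircle => logChord (max ‖p.1‖ (max ‖p.2‖ ‖p.1 - p.2‖))) =ᵐ[volume]
      fun p => firstSide p + firstSide p.swap + firstSide (-p.1 + p.2, -p.1 + p.2 + p.1) := by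
  have h1 := ae_norm_ne (f := fun _ v => v) (by fun_prop) (fun u => Function.injective_id) id
    measurable_id
  have h2 := ae_norm_ne (f := fun u v => u - v) (by fun_prop) (fun u => sub_right_injective) id
    measurable_id
  have h3 : ∀ᵐ p : UnitAddCircle × UnitAddCircle, ‖p.2 - p.1‖ ≠ ‖p.2‖ := by
    have := ae_norm_ne (f := fun u v => u - v) (by fun_prop) (fun u => sub_right_injective) id
      measurable_id
    have hmp := Measure.measurePreserving_swap (μ := (volume : Measure UnitAddCircle))
      (ν := (volume : Measure UnitAddCircle))
    exact hmp.quasiMeasurePreserving.ae this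
  filter_upwards [h1, h2, h3] with ⟨u, v⟩ h1 h2 h3
  simp only [id, firstSide, Prod.swap, neg_add_eq_sub] at *
  rw [sub_add_cancel, show v - u - v = -u by abel, norm_neg, norm_sub_rev v u] at *
  by_cases a : ‖v‖ < ‖u‖
  · by_cases b : ‖u - v‖ < ‖u‖
    · rw [if_pos ⟨a.le, b.le⟩, if_neg (fun h => absurd h.1 (not_le.2 a)),
        if_neg (fun h => absurd h.2 (not_le.2 b)), max_eq_left (max_le a.le b.le)]
      ring
    · have b' : ‖u‖ < ‖u - v‖ := lt_of_le_of_ne (not_lt.1 b) (Ne.symm h2)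
      rw [if_neg (fun h => b'.not_ge h.2), if_neg (fun h => absurd h.1 (not_le.2 a)),
        if_pos ⟨(a.trans b').le, b'.le⟩, max_eq_right (le_max_of_le_right b'.le),
        max_eq_right (a.trans b').le]
      ring
  · have a' : ‖u‖ < ‖v‖ := lt_of_le_of_ne (not_lt.1 a) (Ne.symm h1)
    by_cases b : ‖u - v‖ < ‖v‖
    · rw [if_neg (fun h => a'.not_ge h.1), if_pos ⟨a'.le, b.le⟩,
        if_neg (fun h => absurd h.1 (not_le.2 b)), max_eq_left b.le, max_eq_right a'.le]
      ring
    · have b' : ‖v‖ < ‖u - v‖ := lt_of_le_of_ne (not_lt.1 b) (Ne.symm h3)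
      rw [if_neg (fun h => a'.not_ge h.1), if_neg (fun h => b'.not_ge h.2),
        if_pos ⟨b'.le, (a'.trans b').le⟩, max_eq_right b'.le, max_eq_right (a'.trans b').le]
      ring

theorem integral_logChord_max :
    ∫ p : UnitAddCircle × UnitAddCircle, logChord (max ‖p.1‖ (max ‖p.2‖ ‖p.1 - p.2‖)) =
      4 * (∑' k : ℕ, 1 / (k : ℝ) ^ 3) / π ^ 2 := by
  have hs : MeasurePreserving (Prod.swap : UnitAddCircle × UnitAddCircle → _) volume volume :=
    Measure.measurePreserving_swap
  have ht : MeasurePreserving (fun p : UnitAddCircle × UnitAddCircle =>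
      (-p.1 + p.2, -p.1 + p.2 + p.1)) volume volume :=
    (measurePreserving_prod_add volume volume).comp
      (hs.comp (measurePreserving_prod_neg_add volume volume))
  have hm := measurable_firstSide.aestronglyMeasurable (μ := volume)
  have hi1 : Integrable (fun p => firstSide (Prod.swap p)) volume :=
    (hs.integrable_comp hm).2 integrable_firstSide
  have hi2 : Integrable (fun p : UnitAddCircle × UnitAddCircle =>
      firstSide (-p.1 + p.2, -p.1 + p.2 + p.1)) volume :=
    (ht.integrable_comp hm).2 integrable_firstSide
  have e1 : ∫ p, firstSide (Prod.swap p) = ∫ p, firstSide p := by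
    conv_rhs => rw [← hs.map_eq]
    rw [integral_map hs.measurable.aemeasurable (by rw [hs.map_eq]; exact hm)]
  have e2 : ∫ p : UnitAddCircle × UnitAddCircle, firstSide (-p.1 + p.2, -p.1 + p.2 + p.1) =
      ∫ p, firstSide p := by
    conv_rhs => rw [← ht.map_eq]
    rw [integral_map ht.measurable.aemeasurable (by rw [ht.map_eq]; exact hm)]
  have hi : Integrable (fun p => firstSide p + firstSide (Prod.swap p)) volume :=
    integrable_firstSide.add hi1
  rw [integral_congr_ae logChord_max_eq, integral_add hi hi2,
    integral_add integrable_firstSide hi1, e1, e2, integral_firstSide]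
  ring

/-- The length of the longest side of the triangle with vertices `1`, `e(p 0)`, `e(p 1)`. -/
noncomputable def torusSide (p : UnitAddTorus (Fin 2)) : ℝ :=
  side (AddCircle.toCircle (p 0)) (AddCircle.toCircle (p 1))

theorem riemannZeta_re_eq_tsum (k : ℕ) (hk : 1 < k) :
    (riemannZeta k).re = ∑' n : ℕ, 1 / (n : ℝ) ^ k := by
  rw [zeta_nat_eq_tsum_of_gt_one hk]
  have : ∀ n : ℕ, 1 / (n : ℂ) ^ k = ((1 / (n : ℝ) ^ k : ℝ) : ℂ) := fun n => by push_cast; rfl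
  simp_rw [this]
  rw [← Complex.ofReal_tsum, Complex.ofReal_re]

theorem integral_log_torusSide : ∫ p, log (torusSide p) = eta := by
  have hmp := volume_preserving_finTwoArrow UnitAddCircle
  have h := hmp.integral_comp' (fun p : UnitAddCircle × UnitAddCircle =>
    logChord (max ‖p.1‖ (max ‖p.2‖ ‖p.1 - p.2‖)))
  have e : ∀ p : UnitAddTorus (Fin 2), log (torusSide p) =
      logChord (max ‖p 0‖ (max ‖p 1‖ ‖p 0 - p 1‖)) := fun p => by
    rw [torusSide, side_toCircle, logChord]
  simp_rw [e]
  refine h.trans ?_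
  have h3 := riemannZeta_re_eq_tsum 3 (by norm_num)
  have h2 := riemannZeta_re_eq_tsum 2 (by norm_num)
  rw [hasSum_zeta_two.tsum_eq] at h2
  rw [integral_logChord_max, eta]
  push_cast at h2 h3
  rw [h2, h3]
  field_simp
  ring

theorem chord_pos {u : UnitAddCircle} (hu : u ≠ 0) : 0 < 2 * sin (π * ‖u‖) := by
  have h1 := norm_pos_iff.2 hu
  have h2 := norm_le_half u
  have := sin_pos_of_pos_of_lt_pi (mul_pos pi_pos h1) (by nlinarith [pi_pos])
  positivity

/-- Cutting off the logarithmic singularity changes the integral by little. -/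
theorem tendsto_integral_log_max :
    Tendsto (fun δ : ℝ => ∫ u : UnitAddCircle, log (max (2 * sin (π * ‖u‖)) δ)) (𝓝[>] 0) (𝓝 0) := by
  have key : Tendsto (fun δ : ℝ => ∫ u : UnitAddCircle, log (max (2 * sin (π * ‖u‖)) δ)) (𝓝[>] 0)
      (𝓝 (∫ u : UnitAddCircle, logChord ‖u‖)) := by
    have h0 : ∀ᵐ u : UnitAddCircle, u ≠ 0 := by simp [ae_iff]
    refine tendsto_integral_filter_of_dominated_convergence (fun u => |logChord ‖u‖| + log 2)
      ?_ ?_ ?_ ?_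
    · refine Eventually.of_forall fun δ => ?_
      apply Measurable.aestronglyMeasurable
      fun_prop
    · filter_upwards [Ioo_mem_nhdsGT (zero_lt_one (α := ℝ))] with δ hδ
      filter_upwards [h0] with u hu
      have hc := chord_pos hu
      have hc2 : 2 * sin (π * ‖u‖) ≤ 2 := by linarith [sin_le_one (π * ‖u‖)]
      have h2 : 0 ≤ log 2 := log_nonneg one_le_two
      have hlow : logChord ‖u‖ ≤ log (max (2 * sin (π * ‖u‖)) δ) :=
        log_le_log hc (le_max_left _ _)
      have hup : log (max (2 * sin (π * ‖u‖)) δ) ≤ log 2 :=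
        log_le_log (lt_max_of_lt_left hc) (max_le hc2 (by linarith [hδ.2]))
      rw [Real.norm_eq_abs, abs_le]
      constructor
      · linarith [neg_abs_le (logChord ‖u‖)]
      · linarith [abs_nonneg (logChord ‖u‖)]
    · exact integrable_logChord_norm.abs.add (integrable_const _)
    · filter_upwards [h0] with u hu
      have hc := chord_pos hu
      have h1 : Tendsto (fun δ : ℝ => max (2 * sin (π * ‖u‖)) δ) (𝓝[>] 0)
          (𝓝 (max (2 * sin (π * ‖u‖)) 0)) :=
        ((continuous_const.max continuous_id).tendsto 0).mono_left nhdsWithin_le_nhds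
      rw [max_eq_left hc.le] at h1
      exact h1.log hc.ne'
  rwa [integral_logChord_norm] at key

end

/-! ### Equidistribution of Galois orbits of torsion points -/

section

open MeasureTheory Real

section embAvg
variable {L : Type*} [Field L] [NumberField L]

theorem embAvg_add {E : Type*} [AddCommGroup E] [Module ℝ E] (f g : (L →ₐ[ℚ] ℂ) → E) :
    embAvg L (fun σ => f σ + g σ) = embAvg L f + embAvg L g := by
  simp only [embAvg, Finset.sum_add_distrib, smul_add]

theorem embAvg_sub {E : Type*} [AddCommGroup E] [Module ℝ E] (f g : (L →ₐ[ℚ] ℂ) → E) :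
    embAvg L (fun σ => f σ - g σ) = embAvg L f - embAvg L g := by
  simp only [embAvg, Finset.sum_sub_distrib, smul_sub]

theorem embAvg_map {E F : Type*} [AddCommGroup E] [Module ℝ E] [AddCommGroup F] [Module ℝ F]
    (φ : E →ₗ[ℝ] F) (f : (L →ₐ[ℚ] ℂ) → E) :
    embAvg L (fun σ => φ (f σ)) = φ (embAvg L f) := by
  simp only [embAvg, map_smul, map_sum]

theorem embAvg_const {E : Type*} [AddCommGroup E] [Module ℝ E] (c : E) :
    embAvg L (fun _ => c) = c := by
  have h : Fintype.card (L →ₐ[ℚ] ℂ) = Module.finrank ℚ L := AlgHom.card ℚ L ℂ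
  have h0 : (Module.finrank ℚ L : ℝ) ≠ 0 := by exact_mod_cast (Module.finrank_pos).ne'
  rw [embAvg, Finset.sum_const, Finset.card_univ, h, ← Nat.cast_smul_eq_nsmul ℝ, smul_smul,
    inv_mul_cancel₀ h0, one_smul]

theorem embAvg_mono {f g : (L →ₐ[ℚ] ℂ) → ℝ} (h : ∀ σ, f σ ≤ g σ) : embAvg L f ≤ embAvg L g :=
  mul_le_mul_of_nonneg_left (Finset.sum_le_sum fun σ _ => h σ) (by positivity)

theorem norm_embAvg_le_of_le {E : Type*} [NormedAddCommGroup E] [NormedSpace ℝ E]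
    {f : (L →ₐ[ℚ] ℂ) → E} {C : ℝ} (h : ∀ σ, ‖f σ‖ ≤ C) : ‖embAvg L f‖ ≤ C := by
  have h1 : ‖embAvg L f‖ ≤ embAvg L fun σ => ‖f σ‖ := by
    rw [embAvg, embAvg, norm_smul, Real.norm_of_nonneg (by positivity), smul_eq_mul]
    gcongr
    exact norm_sum_le _ _
  exact h1.trans ((embAvg_mono h).trans_eq (embAvg_const C))

end embAvg

/-- The point of `ℝ/ℤ` corresponding to the argument of a complex number. -/
noncomputable def circlePt (z : ℂ) : UnitAddCircle :=
  ((Complex.arg z / (2 * π) : ℝ) : UnitAddCircle)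

theorem toCircle_circlePt {z : ℂ} (hz : ‖z‖ = 1) : (AddCircle.toCircle (circlePt z) : ℂ) = z := by
  rw [circlePt, AddCircle.toCircle_apply_mk, Circle.coe_exp]
  have hpi := pi_ne_zero
  rw [show 2 * π / 1 * (Complex.arg z / (2 * π)) = Complex.arg z by field_simp]
  have := Complex.norm_mul_exp_arg_mul_I z
  rwa [hz, Complex.ofReal_one, one_mul] at this

/-- The point of the compact torus with the arguments of two complex numbers as coordinates. -/
noncomputable def torusPt (x y : ℂ) : UnitAddTorus (Fin 2) := ![circlePt x, circlePt y]

theorem mFourier_torusPt {x y : ℂ} (hx : ‖x‖ = 1) (hy : ‖y‖ = 1) (n : Fin 2 → ℤ) :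
    UnitAddTorus.mFourier n (torusPt x y) = x ^ n 0 * y ^ n 1 := by
  have h : ∀ (z : ℂ) (hz : ‖z‖ = 1) (k : ℤ), fourier k (circlePt z) = z ^ k := fun z hz k => by
    rw [fourier_apply, AddCircle.toCircle_zsmul, Circle.coe_zpow, toCircle_circlePt hz]
  change ∏ i, fourier (n i) (torusPt x y i) = _
  rw [Fin.prod_univ_two]
  exact congrArg₂ _ (h x hx _) (h y hy _)

theorem torusSide_torusPt {x y : ℂ} (hx : ‖x‖ = 1) (hy : ‖y‖ = 1) :
    torusSide (torusPt x y) = side x y := by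
  change side (AddCircle.toCircle (circlePt x)) (AddCircle.toCircle (circlePt y)) = _
  rw [toCircle_circlePt hx, toCircle_circlePt hy]

theorem isPrimitiveRoot_character (ω : Torus 2) (m n : ℤ) :
    IsPrimitiveRoot (invCoord ω 0 ^ m * invCoord ω 1 ^ n) (orderOf (ω 0 ^ m * ω 1 ^ n)) := by
  refine IsPrimitiveRoot.of_map_of_injective (f := (torusField ω).val) ?_
    (torusField ω).val.injective
  have h := IsPrimitiveRoot.orderOf ((ω 0 ^ m * ω 1 ^ n)⁻¹)
  rw [orderOf_inv, ← IsPrimitiveRoot.coe_units_iff] at h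
  convert! h using 1
  rw [map_mul, map_zpow₀, map_zpow₀]
  change ((ω 0 : QBar)⁻¹) ^ m * ((ω 1 : QBar)⁻¹) ^ n = _
  push_cast
  rw [inv_zpow, inv_zpow, mul_inv]

theorem norm_embedding_invCoord {ω : Torus 2} (hω : IsOfFinOrder ω)
    (σ : torusField ω →ₐ[ℚ] ℂ) (i : Fin 2) : ‖σ (invCoord ω i)‖ = 1 := by
  obtain ⟨N, hN, h⟩ := isOfFinOrder_iff_pow_eq_one.1 hω
  refine Complex.norm_eq_one_of_pow_eq_one (n := N) ?_ hN.ne'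
  have : invCoord ω i ^ N = 1 := by
    apply Subtype.ext
    change ((ω i : QBar)⁻¹) ^ N = 1
    have h1 : (ω i : QBar) ^ N = 1 := by simpa using congrArg Units.val (congrFun h i)
    rw [inv_pow, h1, inv_one]
  rw [← map_pow, this, map_one]

/-- A filter on the torus concentrated on torsion points, along which no nontrivial character
stays of bounded order. -/
structure IsGenericTorsion (𝓕 : Filter (Torus 2)) : Prop where
  torsion : ∀ᶠ ω in 𝓕, IsOfFinOrder ω
  order : ∀ m n : ℤ, m ≠ 0 ∨ n ≠ 0 → Tendsto (fun ω => orderOf (ω 0 ^ m * ω 1 ^ n)) 𝓕 atTop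

instance : IsProbabilityMeasure (volume : Measure UnitAddCircle) := ⟨UnitAddCircle.measure_univ⟩

theorem integral_mFourier {n : Fin 2 → ℤ} (hn : n ≠ 0) : ∫ p, UnitAddTorus.mFourier n p = 0 := by
  obtain ⟨i, hi⟩ := Function.ne_iff.1 hn
  change ∫ p : Fin 2 → UnitAddCircle, ∏ i, fourier (n i) (p i) = 0
  rw [MeasureTheory.integral_fintype_prod_volume_eq_prod
    (f := fun i (u : UnitAddCircle) => fourier (n i) u)]
  refine Finset.prod_eq_zero (Finset.mem_univ i) ?_
  exact integral_eq_zero_of_add_right_eq_neg (fourier_add_half_inv_index hi one_pos)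

namespace IsGenericTorsion
variable {𝓕 : Filter (Torus 2)}

theorem tendsto_orbitAvg_mFourier (h𝓕 : IsGenericTorsion 𝓕) (n : Fin 2 → ℤ) :
    Tendsto (fun ω => orbitAvg ω fun x y => UnitAddTorus.mFourier n (torusPt x y)) 𝓕
      (𝓝 (∫ p, UnitAddTorus.mFourier n p)) := by
  rcases eq_or_ne n 0 with rfl | hn
  · have : ∀ ω, orbitAvg ω (fun x y => UnitAddTorus.mFourier (0 : Fin 2 → ℤ) (torusPt x y)) = 1 := by
      intro ω
      simp only [orbitAvg, UnitAddTorus.mFourier_zero, ContinuousMap.one_apply, embAvg_const]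
    rw [funext this]
    simp only [UnitAddTorus.mFourier_zero, ContinuousMap.one_apply, integral_const, probReal_univ,
      one_smul]
    exact tendsto_const_nhds
  · have hn' : n 0 ≠ 0 ∨ n 1 ≠ 0 := by
      by_contra! h
      exact hn (by ext i; fin_cases i <;> simp [h.1, h.2])
    have hord := h𝓕.order _ _ hn'
    rw [integral_mFourier hn]
    have hlim : Tendsto (fun ω => ((orderOf (ω 0 ^ n 0 * ω 1 ^ n 1)).totient : ℝ)⁻¹) 𝓕 (𝓝 0) :=
      tendsto_inv_atTop_zero.comp
        (tendsto_natCast_atTop_atTop.comp (tendsto_totient_atTop.comp hord))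
    refine squeeze_zero_norm' ?_ hlim
    filter_upwards [h𝓕.torsion, hord.eventually_ge_atTop 1] with ω hω h1
    have : (orbitAvg ω fun x y => UnitAddTorus.mFourier n (torusPt x y)) =
        embAvg (torusField ω) fun σ => σ (invCoord ω 0 ^ n 0 * invCoord ω 1 ^ n 1) := by
      rw [orbitAvg]
      congr 1
      funext σ
      rw [mFourier_torusPt (norm_embedding_invCoord hω σ 0) (norm_embedding_invCoord hω σ 1),
        map_mul, map_zpow₀, map_zpow₀]
    rw [this]
    exact norm_embAvg_root_le h1 (isPrimitiveRoot_character ω _ _)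

theorem tendsto_orbitAvg_complex (h𝓕 : IsGenericTorsion 𝓕) (f : C(UnitAddTorus (Fin 2), ℂ)) :
    Tendsto (fun ω => orbitAvg ω fun x y => f (torusPt x y)) 𝓕 (𝓝 (∫ p, f p)) := by
  have hint : ∀ f : C(UnitAddTorus (Fin 2), ℂ), Integrable f := fun f =>
    f.continuous.integrable_of_hasCompactSupport (HasCompactSupport.of_compactSpace f)
  have hspan : ∀ g ∈ Submodule.span ℂ (Set.range (UnitAddTorus.mFourier (d := Fin 2))),
      Tendsto (fun ω => orbitAvg ω fun x y => g (torusPt x y)) 𝓕 (𝓝 (∫ p, g p)) := by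
    intro g hg
    induction hg using Submodule.span_induction with
    | mem g hg =>
      obtain ⟨n, rfl⟩ := hg
      exact h𝓕.tendsto_orbitAvg_mFourier n
    | zero =>
      simp only [ContinuousMap.zero_apply, orbitAvg, embAvg_const, integral_zero]
      exact tendsto_const_nhds
    | add g₁ g₂ _ _ h₁ h₂ =>
      simp only [ContinuousMap.add_apply, orbitAvg, embAvg_add] at *
      rw [integral_add (hint _) (hint _)]
      exact h₁.add h₂
    | smul c g _ h =>
      have hφ : ∀ ω, (orbitAvg ω fun x y => (c • g) (torusPt x y)) =
          c * orbitAvg ω fun x y => g (torusPt x y) := fun ω =>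
        embAvg_map (LinearMap.mulLeft ℝ c) _
      rw [funext hφ]
      simp only [ContinuousMap.smul_apply, smul_eq_mul]
      rw [integral_const_mul]
      exact h.const_mul c
  have hcl : f ∈ (Submodule.span ℂ
      (Set.range (UnitAddTorus.mFourier (d := Fin 2)))).topologicalClosure := by
    rw [UnitAddTorus.span_mFourier_closure_eq_top]; trivial
  rw [Metric.tendsto_nhds]
  intro ε hε
  obtain ⟨g, hg, hfg⟩ := Metric.mem_closure_iff.1 hcl (ε / 3) (by positivity)
  have hbd : ∀ p, ‖f p - g p‖ ≤ ε / 3 := fun p => by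
    have := (f - g).norm_coe_le_norm p
    rw [← dist_eq_norm] at this
    rw [dist_eq_norm] at hfg
    exact ((f - g).norm_coe_le_norm p).trans hfg.le
  filter_upwards [(Metric.tendsto_nhds.1 (hspan g hg)) (ε / 3) (by positivity)] with ω hω
  have h1 : ‖(orbitAvg ω fun x y => f (torusPt x y)) - orbitAvg ω fun x y => g (torusPt x y)‖
      ≤ ε / 3 := by
    rw [orbitAvg, orbitAvg, ← embAvg_sub]
    exact norm_embAvg_le_of_le fun σ => hbd _
  have h2 : ‖(∫ p, g p) - ∫ p, f p‖ ≤ ε / 3 := by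
    rw [← integral_sub (hint _) (hint _)]
    have := norm_integral_le_of_norm_le_const (μ := (volume : Measure (UnitAddTorus (Fin 2))))
      (f := fun p => g p - f p) (C := ε / 3)
      (Eventually.of_forall fun p => by rw [norm_sub_rev]; exact hbd p)
    simpa using this
  rw [dist_eq_norm] at hω ⊢
  calc _ = ‖((orbitAvg ω fun x y => f (torusPt x y)) - orbitAvg ω fun x y => g (torusPt x y)) +
        ((orbitAvg ω fun x y => g (torusPt x y)) - ∫ p, g p) + ((∫ p, g p) - ∫ p, f p)‖ := by
        congr 1; ring
    _ ≤ _ := norm_add₃_le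
    _ < ε := by linarith

/-- Galois orbits of generic torsion points are equidistributed in the compact torus. -/
theorem tendsto_orbitAvg (h𝓕 : IsGenericTorsion 𝓕) {f : UnitAddTorus (Fin 2) → ℝ}
    (hf : Continuous f) :
    Tendsto (fun ω => orbitAvg ω fun x y => f (torusPt x y)) 𝓕 (𝓝 (∫ p, f p)) := by
  have h := h𝓕.tendsto_orbitAvg_complex ⟨fun p => (f p : ℂ), by fun_prop⟩
  have h2 := (Complex.continuous_re.tendsto _).comp h
  simp only [ContinuousMap.coe_mk, integral_complex_ofReal, Complex.ofReal_re] at h2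
  refine h2.congr fun ω => ?_
  exact (embAvg_map Complex.reLm _).symm

end IsGenericTorsion

end

/-! ### The logarithmic singularity and the limit of heights -/

section

open MeasureTheory Real

theorem continuous_torusSide : Continuous torusSide := by
  have := AddCircle.continuous_toCircle (T := (1 : ℝ))
  unfold torusSide side; fun_prop

theorem torusSide_le_two (p : UnitAddTorus (Fin 2)) : torusSide p ≤ 2 := by
  have h : ∀ x y : ℂ, ‖x‖ = 1 → ‖y‖ = 1 → ‖x - y‖ ≤ 2 := fun x y hx hy => by
    calc ‖x - y‖ ≤ ‖x‖ + ‖y‖ := norm_sub_le _ _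
      _ = 2 := by rw [hx, hy]; norm_num
  exact max_le (h _ _ norm_one (Circle.norm_coe _)) (max_le (h _ _ norm_one (Circle.norm_coe _))
    (h _ _ (Circle.norm_coe _) (Circle.norm_coe _)))

theorem log_max_sub_log_nonneg {d : ℝ} (hd : 0 < d) (δ : ℝ) : 0 ≤ log (max d δ) - log d :=
  sub_nonneg.2 (log_le_log hd (le_max_left _ _))

/-- The effect of a cutoff on the logarithm decreases with the argument. -/
theorem log_max_sub_log_le {c d δ : ℝ} (hc : 0 < c) (hcd : c ≤ d) (hδ : 0 < δ) :
    log (max d δ) - log d ≤ log (max c δ) - log c := by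
  have hd : 0 < d := hc.trans_le hcd
  rw [← log_div (by positivity) hd.ne', ← log_div (by positivity) hc.ne']
  refine log_le_log (by positivity) ?_
  rw [← max_div_div_right hd.le, ← max_div_div_right hc.le, div_self hd.ne', div_self hc.ne']
  gcongr

theorem two_mul_sin_le_torusSide (p : UnitAddTorus (Fin 2)) :
    2 * sin (π * ‖p 0‖) ≤ torusSide p := by
  rw [← norm_toCircle_sub_one, norm_sub_rev]
  exact le_max_left _ _

theorem measurePreserving_apply_zero :
    MeasurePreserving (fun p : UnitAddTorus (Fin 2) => p 0) volume volume :=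
  measurePreserving_eval (fun _ : Fin 2 => (volume : Measure UnitAddCircle)) 0

theorem ae_apply_zero_ne : ∀ᵐ p : UnitAddTorus (Fin 2), p 0 ≠ 0 := by
  have h0 : ∀ᵐ u : UnitAddCircle, u ≠ 0 := by simp [ae_iff]
  exact measurePreserving_apply_zero.quasiMeasurePreserving.ae h0

theorem integrable_log_torusSide : Integrable fun p => log (torusSide p) := by
  have h1 : Integrable fun p : UnitAddTorus (Fin 2) => logChord ‖p 0‖ :=
    (measurePreserving_apply_zero.integrable_comp
      (measurable_logChord.comp measurable_norm).aestronglyMeasurable).2 integrable_logChord_norm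
  refine (h1.abs.add (integrable_const (log 2))).mono'
    (measurable_log.comp continuous_torusSide.measurable).aestronglyMeasurable ?_
  filter_upwards [ae_apply_zero_ne] with p hp
  have hc := chord_pos hp
  have hle := two_mul_sin_le_torusSide p
  have hlow : logChord ‖p 0‖ ≤ log (torusSide p) := log_le_log hc hle
  have hup : log (torusSide p) ≤ log 2 := log_le_log (hc.trans_le hle) (torusSide_le_two p)
  have h2 : 0 ≤ log 2 := log_nonneg one_le_two
  rw [Real.norm_eq_abs, abs_le]
  simp only [Pi.add_apply]
  constructor
  · linarith [neg_abs_le (logChord ‖p 0‖)]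
  · linarith [abs_nonneg (logChord ‖p 0‖)]

theorem continuous_log_max {X : Type*} [TopologicalSpace X] {f : X → ℝ} (hf : Continuous f) {δ : ℝ}
    (hδ : 0 < δ) : Continuous fun x => log (max (f x) δ) :=
  (hf.max continuous_const).log fun _ => (lt_max_of_lt_right hδ).ne'

theorem continuous_chord : Continuous fun p : UnitAddTorus (Fin 2) => 2 * sin (π * ‖p 0‖) := by
  fun_prop

theorem integrable_of_continuous {f : UnitAddTorus (Fin 2) → ℝ} (hf : Continuous f) :
    Integrable f :=
  hf.integrable_of_hasCompactSupport (HasCompactSupport.of_compactSpace f)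

theorem integral_log_max_torusSide_mem {δ : ℝ} (hδ : 0 < δ) :
    eta ≤ ∫ p, log (max (torusSide p) δ) ∧ ∫ p, log (max (torusSide p) δ) ≤
      eta + ∫ u : UnitAddCircle, log (max (2 * sin (π * ‖u‖)) δ) := by
  have hI := integrable_of_continuous (continuous_log_max continuous_torusSide hδ)
  have hJ := integrable_of_continuous (continuous_log_max continuous_chord hδ)
  have hK : Integrable fun p : UnitAddTorus (Fin 2) => logChord ‖p 0‖ :=
    (measurePreserving_apply_zero.integrable_comp
      (measurable_logChord.comp measurable_norm).aestronglyMeasurable).2 integrable_logChord_norm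
  have hmap : ∀ f : UnitAddCircle → ℝ, Measurable f →
      ∫ p : UnitAddTorus (Fin 2), f (p 0) = ∫ u, f u := fun f hf => by
    conv_rhs => rw [← measurePreserving_apply_zero.map_eq]
    rw [integral_map measurePreserving_apply_zero.measurable.aemeasurable
      hf.aestronglyMeasurable]
  rw [← integral_log_torusSide]
  constructor
  · refine integral_mono_ae integrable_log_torusSide hI ?_
    filter_upwards [ae_apply_zero_ne] with p hp
    exact sub_nonneg.1 (log_max_sub_log_nonneg
      ((chord_pos hp).trans_le (two_mul_sin_le_torusSide p)) δ)
  · have h1 : ∫ p, (log (max (torusSide p) δ) - log (torusSide p)) ≤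
        ∫ p : UnitAddTorus (Fin 2), (log (max (2 * sin (π * ‖p 0‖)) δ) - logChord ‖p 0‖) := by
      refine integral_mono_ae (hI.sub integrable_log_torusSide) (hJ.sub hK) ?_
      filter_upwards [ae_apply_zero_ne] with p hp
      exact log_max_sub_log_le (chord_pos hp) (two_mul_sin_le_torusSide p) hδ
    rw [integral_sub hI integrable_log_torusSide, integral_sub hJ hK,
      hmap (fun u => logChord ‖u‖) (measurable_logChord.comp measurable_norm),
      hmap (fun u => log (max (2 * sin (π * ‖u‖)) δ)) (by fun_prop), integral_logChord_norm] at h1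
    linarith

namespace IsGenericTorsion
variable {𝓕 : Filter (Torus 2)}

theorem orderOf_tendsto (h𝓕 : IsGenericTorsion 𝓕) :
    Tendsto (fun ω : Torus 2 => orderOf (ω 0)) 𝓕 atTop := by
  simpa using h𝓕.order 1 0 (Or.inl one_ne_zero)

/-- The equidistribution of generic torsion points extends to the test function with a logarithmic
singularity at the identity given by the longest side of the triangle. -/
theorem tendsto_orbitAvg_log_side (h𝓕 : IsGenericTorsion 𝓕) :
    Tendsto (fun ω => orbitAvg ω fun x y => log (side x y)) 𝓕 (𝓝 eta) := by
  rw [Metric.tendsto_nhds]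
  intro ε hε
  -- `δ` is a cutoff whose effect on the integrals is small. Its effect on the averages is at most
  -- the average of `log (max |1 - x| δ)`, because that of `log |1 - x|` is nonnegative.
  obtain ⟨δ, hδI, hδ⟩ := (((tendsto_order.1 tendsto_integral_log_max).2 (ε / 3)
    (by positivity)).and self_mem_nhdsWithin).exists
  have hδ : 0 < δ := hδ
  obtain ⟨hlow, hup⟩ := integral_log_max_torusSide_mem hδ
  have ht1 := h𝓕.tendsto_orbitAvg (continuous_log_max continuous_torusSide hδ)
  have ht2 := h𝓕.tendsto_orbitAvg (continuous_log_max continuous_chord hδ)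
  have hmap : ∫ p : UnitAddTorus (Fin 2), log (max (2 * sin (π * ‖p 0‖)) δ) =
      ∫ u : UnitAddCircle, log (max (2 * sin (π * ‖u‖)) δ) := by
    conv_rhs => rw [← measurePreserving_apply_zero.map_eq]
    rw [integral_map measurePreserving_apply_zero.measurable.aemeasurable
      (Measurable.aestronglyMeasurable (by fun_prop))]
  rw [hmap] at ht2
  filter_upwards [h𝓕.torsion, h𝓕.orderOf_tendsto.eventually_ge_atTop 2,
    (tendsto_order.1 ht1).2 (eta + 2 * ε / 3) (by linarith),
    (tendsto_order.1 ht1).1 (eta - ε / 3) (by linarith),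
    (tendsto_order.1 ht2).2 (ε / 3) hδI] with ω hω hord h1 h2 h3
  have hprim : IsPrimitiveRoot (invCoord ω 0) (orderOf (ω 0)) := by
    simpa using isPrimitiveRoot_character ω 1 0
  have hlog := (embAvg_log_norm_one_sub hord hprim).1
  have hnorm := norm_embedding_invCoord hω
  have hchord : ∀ σ : torusField ω →ₐ[ℚ] ℂ,
      2 * sin (π * ‖torusPt (σ (invCoord ω 0)) (σ (invCoord ω 1)) 0‖) =
        ‖1 - σ (invCoord ω 0)‖ := fun σ => by
    change 2 * sin (π * ‖circlePt (σ (invCoord ω 0))‖) = _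
    rw [← norm_toCircle_sub_one, toCircle_circlePt (hnorm σ 0), norm_sub_rev]
  have hpos : ∀ σ : torusField ω →ₐ[ℚ] ℂ, 0 < ‖1 - σ (invCoord ω 0)‖ := fun σ => by
    rw [norm_pos_iff, sub_ne_zero]
    intro h
    have : invCoord ω 0 = 1 := σ.injective (h.symm.trans (map_one σ).symm)
    exact hprim.ne_one (by omega) this
  have hle : ∀ σ : torusField ω →ₐ[ℚ] ℂ, ‖1 - σ (invCoord ω 0)‖ ≤
      side (σ (invCoord ω 0)) (σ (invCoord ω 1)) := fun σ => le_max_left _ _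
  have e1 : (orbitAvg ω fun x y => log (max (torusSide (torusPt x y)) δ)) =
      embAvg (torusField ω) fun σ =>
        log (max (side (σ (invCoord ω 0)) (σ (invCoord ω 1))) δ) := by
    rw [orbitAvg]
    congr 1
    funext σ
    rw [torusSide_torusPt (hnorm σ 0) (hnorm σ 1)]
  have e2 : (orbitAvg ω fun x y => log (max (2 * sin (π * ‖torusPt x y 0‖)) δ)) =
      embAvg (torusField ω) fun σ => log (max ‖1 - σ (invCoord ω 0)‖ δ) := by
    rw [orbitAvg]
    congr 1
    funext σ
    rw [hchord]
  have i1 : 0 ≤ embAvg (torusField ω) fun σ =>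
      (log (max (side (σ (invCoord ω 0)) (σ (invCoord ω 1))) δ) -
        log (side (σ (invCoord ω 0)) (σ (invCoord ω 1)))) := by
    rw [← embAvg_const (L := torusField ω) (0 : ℝ)]
    exact embAvg_mono fun σ => log_max_sub_log_nonneg ((hpos σ).trans_le (hle σ)) δ
  have i2 := embAvg_mono (L := torusField ω) fun σ => log_max_sub_log_le (hpos σ) (hle σ) hδ
  rw [embAvg_sub, ← e1] at i1 i2
  rw [embAvg_sub, ← e2] at i2
  rw [Real.dist_eq, abs_lt]
  simp only [orbitAvg] at *
  constructor <;> linarith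

theorem tendsto_interHeight (h𝓕 : IsGenericTorsion 𝓕) (h1 : ∀ᶠ ω in 𝓕, ω ≠ 1) :
    Tendsto interHeight 𝓕 (𝓝 eta) := by
  have hlim : Tendsto (fun n : ℕ => 2 * (log n / n)) atTop (𝓝 0) := by
    have : Tendsto (fun x : ℝ => log x / x) atTop (𝓝 0) := by
      simpa using Real.tendsto_pow_log_div_mul_add_atTop 1 0 1 one_ne_zero
    simpa using (this.comp tendsto_natCast_atTop_atTop).const_mul 2
  rw [Metric.tendsto_nhds]
  intro ε hε
  obtain ⟨N, hN⟩ := eventually_atTop.1 ((tendsto_order.1 hlim).2 (ε / 2) (by positivity))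
  filter_upwards [h𝓕.torsion, h1, h𝓕.orderOf_tendsto.eventually_ge_atTop N,
    (Metric.tendsto_nhds.1 h𝓕.tendsto_orbitAvg_log_side) (ε / 2) (by positivity)] with ω hω h1 hord h
  obtain ⟨d, -, hd, hlow, hup⟩ := orbitAvg_sub_le_interHeight hω h1
  have := hN d (hord.trans hd)
  rw [Real.dist_eq, abs_lt] at *
  constructor <;> linarith [h.1, h.2]

end IsGenericTorsion

theorem interHeight_mem_Icc {ω : Torus 2} (hω : IsOfFinOrder ω) (h1 : ω ≠ 1) :
    interHeight ω ∈ Set.Icc 0 (log 2) := by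
  constructor
  · obtain ⟨hv, hsing⟩ := lineC_inter_translate_eq_singleton ω h1
    rw [interHeight, hsing, finsum_mem_singleton, height]
    exact div_nonneg (Height.logHeight_nonneg _) (Nat.cast_nonneg _)
  · obtain ⟨d, -, -, -, hup⟩ := orbitAvg_sub_le_interHeight hω h1
    refine hup.trans ?_
    rw [← embAvg_const (L := torusField ω) (log 2)]
    refine embAvg_mono fun σ => ?_
    beta_reduce
    rw [← torusSide_torusPt (norm_embedding_invCoord hω σ 0) (norm_embedding_invCoord hω σ 1)]
    rcases eq_or_ne (torusSide (torusPt (σ (invCoord ω 0)) (σ (invCoord ω 1)))) 0 with h | h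
    · rw [h, log_zero]; exact log_nonneg one_le_two
    · refine log_le_log (lt_of_le_of_ne ?_ h.symm) (torusSide_le_two _)
      exact le_max_of_le_left (norm_nonneg _)

end

/-! ### Filters of density one and strict sequences -/

section density
variable {α : Type*}

open Classical in
/-- The filter of the sets that contain a proportion of the points of `W ℓ` tending to `1`. -/
noncomputable def densityFilter (W : ℕ → Finset α) : Filter α where
  sets := {S | Tendsto (fun ℓ => (((W ℓ).filter (· ∉ S)).card : ℝ) / (W ℓ).card) atTop (𝓝 0)}
  univ_sets := by simp
  sets_of_superset := by
    intro S T hS hST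
    refine squeeze_zero (fun ℓ => by positivity) (fun ℓ => ?_) hS
    gcongr
  inter_sets := by
    intro S T hS hT
    have h := Tendsto.add hS hT
    rw [add_zero] at h
    refine squeeze_zero (fun ℓ => by positivity) (fun ℓ => ?_) h
    rw [← add_div]
    gcongr
    rw [← Nat.cast_add]
    refine Nat.cast_le.2 ((Finset.card_le_card ?_).trans (Finset.card_union_le _ _))
    intro x hx
    simp only [Finset.mem_filter, Finset.mem_union, Set.mem_inter_iff] at hx ⊢
    tauto

variable {W : ℕ → Finset α}

open Classical in
theorem mem_densityFilter {S : Set α} : S ∈ densityFilter W ↔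
    Tendsto (fun ℓ => (((W ℓ).filter (· ∉ S)).card : ℝ) / (W ℓ).card) atTop (𝓝 0) := Iff.rfl

theorem eventually_densityFilter_of_forall {p : α → Prop} (h : ∀ ℓ, ∀ x ∈ W ℓ, p x) :
    ∀ᶠ x in densityFilter W, p x := by
  classical
  change Tendsto _ _ _
  have : ∀ ℓ, (W ℓ).filter (· ∉ {x | p x}) = ∅ := fun ℓ =>
    Finset.filter_eq_empty_iff.2 fun x hx hn => hn (h ℓ x hx)
  simp only [this]
  simp

theorem tendsto_ncard_div_of_mem_densityFilter (hW : ∀ ℓ, (W ℓ).Nonempty) {S : Set α}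
    (hS : S ∈ densityFilter W) :
    Tendsto (fun ℓ => ({x | x ∈ W ℓ ∧ x ∈ S}.ncard : ℝ) / (W ℓ).card) atTop (𝓝 1) := by
  classical
  rw [mem_densityFilter] at hS
  have h := hS.const_sub 1
  rw [sub_zero] at h
  refine h.congr fun ℓ => ?_
  have hc : ((W ℓ).card : ℝ) ≠ 0 := by exact_mod_cast (hW ℓ).card_pos.ne'
  have h1 : {x | x ∈ W ℓ ∧ x ∈ S} = ((W ℓ).filter (· ∈ S) : Set α) := by ext; simp
  rw [h1, Set.ncard_coe_finset, eq_div_iff hc, sub_mul, div_mul_cancel₀ _ hc, one_mul,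
    sub_eq_iff_eq_add]
  exact_mod_cast (Finset.card_filter_add_card_filter_not (s := W ℓ) (· ∈ S)).symm

/-- Along a filter of density one, a bounded function converges in mean. -/
theorem tendsto_mean_densityFilter (hW : ∀ ℓ, (W ℓ).Nonempty) {f : α → ℝ} {a B : ℝ}
    (hB : ∀ ℓ, ∀ x ∈ W ℓ, |f x - a| ≤ B) (hf : Tendsto f (densityFilter W) (𝓝 a)) :
    Tendsto (fun ℓ => (1 / ((W ℓ).card : ℝ)) * ∑ x ∈ W ℓ, f x) atTop (𝓝 a) := by
  classical
  have hB0 : 0 ≤ B := by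
    obtain ⟨x, hx⟩ := hW 0
    exact (abs_nonneg _).trans (hB 0 x hx)
  rw [Metric.tendsto_nhds]
  intro ε hε
  have hS := mem_densityFilter.1 (Metric.tendsto_nhds.1 hf (ε / 2) (by positivity))
  simp only [Set.mem_ofPred_eq] at hS
  have h2 := hS.const_mul B
  rw [mul_zero] at h2
  filter_upwards [(tendsto_order.1 h2).2 (ε / 2) (by positivity)] with ℓ hℓ
  have hc : (0 : ℝ) < (W ℓ).card := by exact_mod_cast (hW ℓ).card_pos
  have key : |∑ x ∈ W ℓ, (f x - a)| ≤ (W ℓ).card * (ε / 2) +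
      ((W ℓ).filter (fun x => ¬ dist (f x) a < ε / 2)).card * B := by
    refine (Finset.abs_sum_le_sum_abs _ _).trans ?_
    have : ∀ x ∈ W ℓ, |f x - a| ≤ ε / 2 + if dist (f x) a < ε / 2 then 0 else B := by
      intro x hx
      split_ifs with h
      · rw [Real.dist_eq] at h
        linarith
      · linarith [hB ℓ x hx]
    refine (Finset.sum_le_sum this).trans_eq ?_
    rw [Finset.sum_add_distrib, Finset.sum_const, nsmul_eq_mul, Finset.sum_ite,
      Finset.sum_const_zero, zero_add, Finset.sum_const, nsmul_eq_mul]
  rw [Finset.sum_sub_distrib, Finset.sum_const, nsmul_eq_mul] at key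
  have e : 1 / ((W ℓ).card : ℝ) * ∑ x ∈ W ℓ, f x - a =
      (∑ x ∈ W ℓ, f x - (W ℓ).card * a) / (W ℓ).card := by field_simp
  rw [Real.dist_eq, e, abs_div, abs_of_pos hc, div_lt_iff₀ hc]
  refine key.trans_lt ?_
  rw [← mul_div_assoc, div_lt_iff₀ hc] at hℓ
  linarith

end density

/-- The kernel of a character of the torus. -/
noncomputable def characterKer (m n : ℤ) : Subgroup (Torus 2) :=
  MonoidHom.ker
    { toFun := fun ω : Torus 2 => ω 0 ^ m * ω 1 ^ n
      map_one' := by simp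
      map_mul' := fun x y => by simp only [Pi.mul_apply, mul_zpow]; exact mul_mul_mul_comm _ _ _ _ }

theorem mem_characterKer {m n : ℤ} {ω : Torus 2} :
    ω ∈ characterKer m n ↔ ω 0 ^ m * ω 1 ^ n = 1 := Iff.rfl

theorem isAlgebraicSubgroup_characterKer (m n : ℤ) : IsAlgebraicSubgroup (characterKer m n) := by
  -- The negative powers are moved to the other side of the equation.
  refine ⟨{MvPolynomial.X 0 ^ m.toNat * MvPolynomial.X 1 ^ n.toNat -
    MvPolynomial.X 0 ^ (-m).toNat * MvPolynomial.X 1 ^ (-n).toNat}, fun γ => ?_⟩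
  have hz : ∀ (u : QBarˣ) (k : ℤ), u ^ k = u ^ k.toNat * (u ^ (-k).toNat)⁻¹ := fun u k => by
    conv_lhs => rw [← Int.toNat_sub_toNat_neg k]
    rw [zpow_sub, zpow_natCast, zpow_natCast]
  rw [mem_characterKer, hz, hz (γ 1), mul_mul_mul_comm, ← mul_inv, mul_inv_eq_one]
  simp only [Set.mem_singleton_iff, forall_eq, map_sub, map_mul, map_pow, MvPolynomial.eval_X,
    sub_eq_zero]
  rw [Units.ext_iff]
  push_cast
  rfl

theorem not_univ_subset_characterKer {m n : ℤ} (h : m ≠ 0 ∨ n ≠ 0) :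
    ¬ (Set.univ : Set (Torus 2)) ⊆ (characterKer m n : Set (Torus 2)) := by
  intro hsub
  have h2 : ∀ k : ℤ, k ≠ 0 → (Units.mk0 (2 : QBar) two_ne_zero) ^ k ≠ 1 := by
    intro k hk he
    have h3 : (algebraMap ℚ QBar) ((2 : ℚ) ^ k) = algebraMap ℚ QBar 1 := by
      have := congrArg Units.val he
      rw [map_zpow₀, map_one]
      simpa using this
    have h4 := (algebraMap ℚ QBar).injective h3
    have h5 := zpow_right_injective₀ (a := (2 : ℚ)) (by norm_num) (by norm_num)
      (h4.trans (zpow_zero (2 : ℚ)).symm)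
    exact hk h5
  rcases h with h | h
  · have := hsub (Set.mem_univ ![Units.mk0 (2 : QBar) two_ne_zero, 1])
    rw [SetLike.mem_coe, mem_characterKer] at this
    exact h2 m h (by simpa using this)
  · have := hsub (Set.mem_univ ![1, Units.mk0 (2 : QBar) two_ne_zero])
    rw [SetLike.mem_coe, mem_characterKer] at this
    exact h2 n h (by simpa using this)

/-- A character of order less than `N` at a torsion point is killed by one of its first `N - 1`
powers, which are nontrivial characters; their kernels have density zero. -/
theorem IsStrict.isGenericTorsion {W : ℕ → Finset (Torus 2)} (hW : IsStrict Set.univ W)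
    (htors : ∀ ℓ, ∀ ω ∈ W ℓ, IsOfFinOrder ω) : IsGenericTorsion (densityFilter W) := by
  classical
  have htors' : ∀ᶠ ω in densityFilter W, IsOfFinOrder ω :=
    eventually_densityFilter_of_forall htors
  refine ⟨htors', fun m n hmn => tendsto_atTop.2 fun N => ?_⟩
  have hker : ∀ k ∈ Finset.Ioo 0 N, ∀ᶠ ω : Torus 2 in densityFilter W,
      ω 0 ^ (m * k : ℤ) * ω 1 ^ (n * k : ℤ) ≠ 1 := by
    intro k hk
    have hk0 : (k : ℤ) ≠ 0 := by exact_mod_cast (Finset.mem_Ioo.1 hk).1.ne'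
    have hmn' : m * k ≠ 0 ∨ n * k ≠ 0 := hmn.imp (mul_ne_zero · hk0) (mul_ne_zero · hk0)
    have := hW.2 _ (isAlgebraicSubgroup_characterKer (m * k) (n * k))
      (not_univ_subset_characterKer hmn')
    refine mem_densityFilter.2 (this.congr fun ℓ => ?_)
    congr 2
    rw [← Set.ncard_coe_finset]
    congr 1
    ext ω
    simp [mem_characterKer]
  filter_upwards [htors', (Filter.eventually_all_finset _).2 hker] with ω hω hne
  by_contra! hlt
  have hpos : 0 < orderOf (ω 0 ^ m * ω 1 ^ n) := by
    rw [orderOf_pos_iff]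
    have hi : ∀ i, IsOfFinOrder (ω i) := fun i => hω.apply i
    exact ((hi 0).zpow).mul ((hi 1).zpow)
  refine hne _ (Finset.mem_Ioo.2 ⟨hpos, hlt⟩) ?_
  rw [zpow_mul, zpow_mul, ← mul_zpow, zpow_natCast, pow_orderOf_eq_one]

end TorusHeight

theorem theorem5p5
    (W : ℕ → Finset (TorusHeight.Torus 2))
    (hstrict : TorusHeight.IsStrict Set.univ W)
    (htors : ∀ ℓ, ∀ ω ∈ W ℓ, IsOfFinOrder ω ∧ ω ≠ 1) :
    (∀ ε : ℝ, 0 < ε →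
      Filter.Tendsto
        (fun ℓ => (({ω | ω ∈ W ℓ ∧ |TorusHeight.interHeight ω - TorusHeight.eta| < ε}.ncard : ℝ) /
          ((W ℓ).card : ℝ)))
        Filter.atTop (nhds 1)) ∧
      Filter.Tendsto
        (fun ℓ => (1 / ((W ℓ).card : ℝ)) * ∑ ω ∈ W ℓ, TorusHeight.interHeight ω)
        Filter.atTop (nhds TorusHeight.eta) := by
  have hne : ∀ ℓ, (W ℓ).Nonempty := fun ℓ => (hstrict.1 ℓ).1
  have hgen := hstrict.isGenericTorsion fun ℓ ω hω => (htors ℓ ω hω).1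
  have hlim := hgen.tendsto_interHeight
    (TorusHeight.eventually_densityFilter_of_forall fun ℓ ω hω => (htors ℓ ω hω).2)
  refine ⟨fun ε hε => ?_, ?_⟩
  · exact TorusHeight.tendsto_ncard_div_of_mem_densityFilter hne (Metric.tendsto_nhds.1 hlim ε hε)
  · refine TorusHeight.tendsto_mean_densityFilter hne
      (B := Real.log 2 + |TorusHeight.eta|) (fun ℓ ω hω => ?_) hlim
    have h := TorusHeight.interHeight_mem_Icc (htors ℓ ω hω).1 (htors ℓ ω hω).2
    refine (abs_sub _ _).trans ?_
    rw [abs_of_nonneg h.1]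
    linarith [h.2]
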